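/- Let $S^1=\mathbb R/\mathbb Z$ and let $s>3/2$. Let $H^s=H^s(S^1)$ be the Sobolev space of real functions on $S^1$ with norm $\|u\|^2=\sum_{n\in\mathbb Z}(1+n^2)^s|\hat u(n)|^2$. Let $\mathcal D^s=\mathcal D^s(S^1)$ be the Hilbert manifold of orientation-preserving diffeomorphisms of $S^1$ of class $H^s$, that is, of the diffeomorphisms of the form $\eta(x)=x+g(x) \bmod 1$ with $g\in H^s$ and $1+g_x>0$; the displacement $g$, determined up to an integer constant, is a local coordinate. Let $\mu(u)=\int_{S^1}u\,dx$ and let $A=\mu-\partial_x^2$, which is invertible from $H^{r}$ onto $H^{r-2}$ for every real $r$. For $\eta\in\mathcal D^s$ and $w\in H^s$ put $$f(\eta,w)=-\Big\{A^{-1}\partial_x\Big(2\mu(u)\,u+\tfrac12 (u_x)^2\Big)\Big\}\circ\eta,\qquad u=w\circ\eta^{-1}.$$ **Theorem.** For every $u_o\in H^s(S^1)$ there exist $T>0$ and an open neighbourhood $N$ of $u_o$ in $H^s$ such that the following holds. For every $u\in N$ the initial value problem $$\ddot\eta=f(\eta,\dot\eta),\qquad \eta(0)=\mathrm{id},\quad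 \dot\eta(0)=u$$ has a solution $(\eta,\dot\eta)\in C^1((-T,T),\mathcal D^s\times H^s)$, and this solution is unique: for every $0<T'\le T$, every solution in $C^1((-T',T'),\mathcal D^s\times H^s)$ with the same initial data coincides with it on $(-T',T')$. Moreover the solution depends differentiably on the initial data: the map $(t,u)\mapsto(\eta(t),\dot\eta(t))$, where $(\eta,\dot\eta)$ is the solution with initial velocity $u$, is of class $C^1$ from $(-T,T)\times N$ to $\mathcal D^s\times H^s$. -/

import Mathlib

open Set Filter Topology MeasureTheory

noncomputable section

/-! The circle is `UnitAddCircle`, that is `ℝ / ℤ`. -/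

/-- The `n`-th Fourier coefficient `∫ u(x) e^{-2πinx} dx` of a real function on the circle. -/
def realFourierCoeff (u : UnitAddCircle → ℝ) (n : ℤ) : ℂ :=
  fourierCoeff (fun x => (u x : ℂ)) n

theorem realFourierCoeff_add (u v : C(UnitAddCircle, ℝ)) (n : ℤ) :
    realFourierCoeff (u + v : C(UnitAddCircle, ℝ)) n
      = realFourierCoeff u n + realFourierCoeff v n := by
  have hu : Continuous fun x : UnitAddCircle => fourier (-n) x • ((u x : ℝ) : ℂ) := by fun_prop
  have hv : Continuous fun x : UnitAddCircle => fourier (-n) x • ((v x : ℝ) : ℂ) := by fun_prop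
  unfold realFourierCoeff fourierCoeff
  rw [← integral_add (hu.integrable_of_hasCompactSupport (.of_compactSpace _))
    (hv.integrable_of_hasCompactSupport (.of_compactSpace _))]
  simp [mul_add]

theorem realFourierCoeff_smul (c : ℝ) (u : C(UnitAddCircle, ℝ)) (n : ℤ) :
    realFourierCoeff (c • u : C(UnitAddCircle, ℝ)) n = (c : ℂ) * realFourierCoeff u n := by
  have h := fourierCoeff.const_mul (T := 1) (fun x => ((u x : ℝ) : ℂ)) (c : ℂ) n
  simpa [realFourierCoeff] using h

theorem eq_zero_of_realFourierCoeff (u : C(UnitAddCircle, ℝ))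
    (h : ∀ n, realFourierCoeff u n = 0) : u = 0 := by
  let U : C(UnitAddCircle, ℂ) := ⟨fun x => ((u x : ℝ) : ℂ), by fun_prop⟩
  have hU : ∀ n, fourierCoeff U n = 0 := h
  ext x
  have hs := has_pointwise_sum_fourier_series_of_summable (f := U)
    (by simp [funext hU]) x
  simp only [hU, zero_smul] at hs
  have : U x = 0 := hs.unique hasSum_zero
  simpa [U] using this

/-- The Fourier coefficients of `u` with the Sobolev weight `(1 + n²)^(s/2)`. -/
def sobolevCoeff (s : ℝ) (u : UnitAddCircle → ℝ) (n : ℤ) : ℂ :=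
  (((1 + (n : ℝ) ^ 2) ^ (s / 2) : ℝ) : ℂ) * realFourierCoeff u n

/-- The real functions `u` on the circle with `∑ (1 + n²)^s |û(n)|² < ∞`, as a space of continuous
functions: for `s > 1/2` each class in `H^s(S¹)` has exactly one continuous representative. -/
def sobolevSubmodule (s : ℝ) : Submodule ℝ C(UnitAddCircle, ℝ) where
  carrier := {u | Memℓp (sobolevCoeff s u) 2}
  zero_mem' := by
    have : sobolevCoeff s (0 : C(UnitAddCircle, ℝ)) = 0 := by
      ext n
      simp [sobolevCoeff, realFourierCoeff, fourierCoeff]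
    simpa only [mem_ofPred_eq, this] using zero_memℓp
  add_mem' := by
    intro u v hu hv
    have : sobolevCoeff s (u + v : C(UnitAddCircle, ℝ))
        = sobolevCoeff s u + sobolevCoeff s v := by
      ext n
      simp only [sobolevCoeff, realFourierCoeff_add, Pi.add_apply, mul_add]
    simpa only [mem_ofPred_eq, this] using Memℓp.add hu hv
  smul_mem' := by
    intro c u hu
    have : sobolevCoeff s (c • u : C(UnitAddCircle, ℝ)) = (c : ℂ) • sobolevCoeff s u := by
      ext n
      simp only [sobolevCoeff, realFourierCoeff_smul, Pi.smul_apply, smul_eq_mul]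
      ring
    simpa only [mem_ofPred_eq, this] using Memℓp.const_smul hu (c : ℂ)

/-- The Sobolev space `H^s(S¹)` of real functions on the circle (for `s > 1/2`). -/
def Hs (s : ℝ) : Type := sobolevSubmodule s

namespace Hs

instance (s : ℝ) : AddCommGroup (Hs s) := inferInstanceAs (AddCommGroup (sobolevSubmodule s))

instance (s : ℝ) : Module ℝ (Hs s) := inferInstanceAs (Module ℝ (sobolevSubmodule s))

/-- The underlying continuous function. -/
def toCont {s : ℝ} (u : Hs s) : C(UnitAddCircle, ℝ) := Subtype.val u

instance (s : ℝ) : CoeFun (Hs s) (fun _ => UnitAddCircle → ℝ) := ⟨fun u x => u.toCont x⟩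

/-- The weighted Fourier coefficients of `u` as an element of `ℓ²(ℤ)`. -/
def toEll2 (s : ℝ) : Hs s →ₗ[ℝ] lp (fun _ : ℤ => ℂ) 2 where
  toFun u := ⟨sobolevCoeff s u, u.2⟩
  map_add' u v := by
    ext n
    exact (congrArg _ (realFourierCoeff_add u.toCont v.toCont n)).trans (mul_add _ _ _)
  map_smul' c u := by
    ext n
    change sobolevCoeff s (c • u.toCont : C(UnitAddCircle, ℝ)) n = c • sobolevCoeff s u n
    simp only [sobolevCoeff, realFourierCoeff_smul, Complex.real_smul]
    ring

theorem toEll2_injective (s : ℝ) : Function.Injective (toEll2 s) := by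
  refine (injective_iff_map_eq_zero (toEll2 s)).2 fun u hu => ?_
  refine Subtype.ext (eq_zero_of_realFourierCoeff u.toCont fun n => ?_)
  have h : sobolevCoeff s u n = 0 := congrFun (congrArg Subtype.val hu) n
  have hpos : (0 : ℝ) < (1 + (n : ℝ) ^ 2) ^ (s / 2) := by positivity
  exact (mul_eq_zero.1 h).resolve_left (by exact_mod_cast hpos.ne')

/-- The norm of `H^s`: `‖u‖² = ∑ (1 + n²)^s |û(n)|²`. -/
instance (s : ℝ) : NormedAddCommGroup (Hs s) :=
  NormedAddCommGroup.induced (Hs s) (lp (fun _ : ℤ => ℂ) 2) (toEll2 s) (toEll2_injective s)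

instance (s : ℝ) : NormedSpace ℝ (Hs s) :=
  NormedSpace.induced ℝ (Hs s) (lp (fun _ : ℤ => ℂ) 2) (toEll2 s)

end Hs

/-- The derivative `∂ₓ u` of a real function on the circle. -/
def circleDeriv (u : UnitAddCircle → ℝ) (x : UnitAddCircle) : ℝ :=
  deriv (fun h : ℝ => u (x + (h : UnitAddCircle))) 0

/-- `g` is a displacement of the circle map `φ`: `φ(x) = x + g(x)` modulo `1`, i.e. `x ↦ x + g(x)`
is a lift of `φ` to the real line. -/
def IsDisplacement {s : ℝ} (φ : UnitAddCircle → UnitAddCircle) (g : Hs s) : Prop :=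
  ∀ x, φ x = x + ((g x : ℝ) : UnitAddCircle)

/-- `D^s(S¹)`, for `s > 3/2`: the orientation-preserving diffeomorphisms of the circle of
class `H^s`. -/
@[ext]
structure Ds (s : ℝ) where
  toHomeomorph : UnitAddCircle ≃ₜ UnitAddCircle
  exists_displacement : ∃ g : Hs s, IsDisplacement toHomeomorph g ∧ ∀ x, 0 < 1 + circleDeriv g x

namespace Ds

instance (s : ℝ) : CoeFun (Ds s) (fun _ => UnitAddCircle → UnitAddCircle) :=
  ⟨fun φ => φ.toHomeomorph⟩

/-- A map `F` into the Hilbert manifold `D^s(S¹)` is `C¹` at `p`. The charts of `D^s(S¹)`, an open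
subset of `id + H^s(S¹)` modulo the integer translations, are the local choices of a displacement,
so this says that `F` is represented near `p` by a `C¹` map into `H^s(S¹)`. -/
def IsC1At {s : ℝ} {E : Type*} [NormedAddCommGroup E] [NormedSpace ℝ E] (F : E → Ds s) (p : E) :
    Prop :=
  ∃ g : E → Hs s, ContDiffAt ℝ 1 g p ∧ ∀ᶠ q in 𝓝 p, IsDisplacement (F q) (g q)

/-- The curve `η` in `D^s(S¹)` has the velocity `w`, an element of the tangent space `H^s(S¹)`,
at time `t`. (Two displacements of a circle map differ by a constant integer, so that the velocity
does not depend on the choice of `g`.) -/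
def HasVelocityAt {s : ℝ} (η : ℝ → Ds s) (w : Hs s) (t : ℝ) : Prop :=
  ∃ g : ℝ → Hs s, HasDerivAt g w t ∧ ∀ᶠ r in 𝓝 t, IsDisplacement (η r) (g r)

end Ds

/-- The mean `μ(u) = ∫ u dx` over the circle. -/
def circleMean (u : UnitAddCircle → ℝ) : ℝ := ∫ x, u x

/-- The Fourier symbol of the inertia operator `A = μ - ∂ₓ²`. -/
def inertiaSymbol (n : ℤ) : ℂ := (if n = 0 then 1 else 0) - (2 * Real.pi * Complex.I * n) ^ 2

/-- The Fourier symbol of `∂ₓ`. -/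
def derivSymbol (n : ℤ) : ℂ := 2 * Real.pi * Complex.I * n

/-- The function `A⁻¹ ∂ₓ h`. The Fourier series converges absolutely when `h` is in `L²`. -/
def inertiaInvDeriv (h : UnitAddCircle → ℝ) (x : UnitAddCircle) : ℂ :=
  ∑' n : ℤ, (inertiaSymbol n)⁻¹ * (derivSymbol n * realFourierCoeff h n) * fourier n x

/-- The Eulerian velocity `w ∘ η⁻¹`. -/
def eulerianVelocity {s : ℝ} (η : Ds s) (w : Hs s) (y : UnitAddCircle) : ℝ :=
  w (η.toHomeomorph.symm y)

/-- The function `2 μ(u) u + (1/2) (∂ₓ u)²`. -/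
def eulerianForce (u : UnitAddCircle → ℝ) (y : UnitAddCircle) : ℝ :=
  2 * circleMean u * u y + (1 / 2) * circleDeriv u y ^ 2

/-- `f(η, w) = -{A⁻¹ ∂ₓ (2 μ(u) u + (1/2) (∂ₓ u)²)} ∘ η`, where `u = w ∘ η⁻¹`. -/
def lagrangianForce {s : ℝ} (η : Ds s) (w : Hs s) (x : UnitAddCircle) : ℂ :=
  -(inertiaInvDeriv (eulerianForce (eulerianVelocity η w)) (η x))

/-- `(η, v)` is a `C¹` solution on `(-T, T)`, with values in `D^s(S¹) × H^s(S¹)`, of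
`η̇ = v`, `v̇ = f(η, v)`, `η(0) = id`, `v(0) = u`. -/
structure IsLagrangianSolution {s : ℝ} (T : ℝ) (u : Hs s) (η : ℝ → Ds s) (v : ℝ → Hs s) :
    Prop where
  c1_left : ∀ t ∈ Ioo (-T) T, Ds.IsC1At η t
  c1_right : ContDiffOn ℝ 1 v (Ioo (-T) T)
  velocity : ∀ t ∈ Ioo (-T) T, Ds.HasVelocityAt η (v t) t
  acceleration : ∀ t ∈ Ioo (-T) T, ∀ x,
    ((deriv v t x : ℝ) : ℂ) = lagrangianForce (η t) (v t) x
  init_left : ∀ x, η 0 x = x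
  init_right : v 0 = u

end

/-!
The displacement `g` of `η(x) = x + g(x)` turns the second order equation on `D^s` into a first order
equation `(g, w)' = (w, f(η, w))` on an open subset of the Hilbert space `H^s × H^s`. The point is
that `f` is a `C¹` function of `(g, w)`, although composition with `η⁻¹` is not a smooth
operation on `H^s`. Put `u = w ∘ η⁻¹`, `h = 2 μ(u) u + (1/2) (∂ₓ u)²` and
`P = A⁻¹ ∂ₓ h`. Then `P` has mean zero and `∂ₓ P = -(h - ∫ h)`, so that `f = -P ∘ η` satisfies

  `∂ₓ f = (h ∘ η) (1 + ∂ₓ g) - (∫ h) (1 + ∂ₓ g)`,  `∫ f (1 + ∂ₓ g) = 0`,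
  `(h ∘ η) (1 + ∂ₓ g) = 2 μ(u) w (1 + ∂ₓ g) + (1/2) (∂ₓ w)² / (1 + ∂ₓ g)`,

where `μ(u) = ∫ w (1 + ∂ₓ g)` and `∫ h = ∫ (h ∘ η) (1 + ∂ₓ g)` by the change of variables `y = η(x)`.
No composition is left: `∂ₓ f` is a rational expression in `w`, `∂ₓ w` and `∂ₓ g`, and these are
elements of `H^(s-1)`, which is a Banach algebra because `s - 1 > 1/2` (`Hs.mulCLM`). Antiderivatives
map `H^(s-1)` to `H^s` (`Hs.antiderivCLM`), so `f` has values in `H^s`. This expression is `Hs.force`;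
it is `C¹` near `g = 0` (`Hs.contDiffAt_force`), where `1 + ∂ₓ g` is invertible by the openness of the
invertible operators, and it agrees there with the Eulerian definition (`Hs.lagrangianForce_eq`).

A vector field of class `C¹` on a Banach space has a local flow of class `C¹`
(`ContDiffAt.exists_contDiffAt_flow`): the implicit function theorem is applied to the integral
equation in `C([0, 1], E)`, with time and initial point as parameters. The flow near `(0, u₀)` gives
the solutions and their `C¹` dependence on `(t, u)`.

For uniqueness, a competing solution need not come with a global displacement, but two displacements
of a circle map differ by an integer (`IsDisplacement.exists_eq_add_intCast`). Near a time at which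
the two solutions agree they can therefore be lifted to integral curves of the same vector field with
the same value, so that the set of times of agreement is open (`IsLagrangianSolution.unique`); it is
closed by continuity.
-/

noncomputable section

/-! ### Superposition operators on spaces of continuous functions -/

section Superposition

variable {K E F : Type*} [TopologicalSpace K] [NormedAddCommGroup E] [NormedAddCommGroup F]

/-- The superposition operator `Y ↦ X ∘ Y` on continuous functions. Its value is `0` where `X ∘ Y`
is not continuous. -/
def superposition (X : E → F) (Y : C(K, E)) : C(K, F) :=
  ContinuousMap.mkD (fun k => X (Y k)) 0

theorem superposition_apply {X : E → F} {Y : C(K, E)} (hX : ∀ k, ContinuousAt X (Y k)) (k : K) :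
    superposition X Y k = X (Y k) :=
  ContinuousMap.mkD_apply_of_continuous (continuous_iff_continuousAt.2 fun j =>
    ContinuousAt.comp (g := X) (f := Y) (hX j) (map_continuous Y).continuousAt)

variable [CompactSpace K]

theorem exists_forall_norm_sub_lt {X : E → F} {Y : C(K, E)} (hX : ∀ k, ContinuousAt X (Y k))
    {ε : ℝ} (hε : 0 < ε) :
    ∃ δ > 0, ∀ k z, ‖z - Y k‖ < δ → ‖X z - X (Y k)‖ < ε := by
  have h := (isCompact_range (map_continuous Y)).uniformContinuousAt_of_continuousAt X
    (by rintro _ ⟨k, rfl⟩; exact hX k) (Metric.dist_mem_uniformity hε)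
  obtain ⟨δ, hδ, H⟩ := Metric.mem_uniformity_dist.1 h
  refine ⟨δ, hδ, fun k z hz => ?_⟩
  have := H (a := Y k) (b := z) (by rwa [dist_comm, dist_eq_norm]) (mem_range_self k)
  rwa [mem_ofPred_eq, dist_comm, dist_eq_norm] at this

theorem isOpen_forall_mem {V : Set E} (hV : IsOpen V) : IsOpen {Y : C(K, E) | ∀ k, Y k ∈ V} := by
  have h := ContinuousMap.isOpen_setOfPred_mapsTo (X := K) (Y := E) isCompact_univ hV
  simpa [MapsTo] using h

theorem continuousOn_superposition {X : E → F} {V : Set E} (hV : IsOpen V)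
    (hX : ContinuousOn X V) :
    ContinuousOn (superposition X : C(K, E) → C(K, F)) {Y | ∀ k, Y k ∈ V} := by
  intro Y hY
  refine ContinuousAt.continuousWithinAt ?_
  have hc : ∀ Z : C(K, E), (∀ k, Z k ∈ V) → ∀ k, ContinuousAt X (Z k) :=
    fun Z hZ k => hX.continuousAt (hV.mem_nhds (hZ k))
  rw [Metric.continuousAt_iff']
  intro ε hε
  obtain ⟨δ, hδ, H⟩ := exists_forall_norm_sub_lt (hc Y hY) (half_pos hε)
  filter_upwards [(isOpen_forall_mem hV).mem_nhds hY, Metric.ball_mem_nhds Y hδ] with Z hZ hZY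
  refine lt_of_le_of_lt ((ContinuousMap.dist_le (half_pos hε).le).2 fun k => ?_) (half_lt_self hε)
  rw [superposition_apply (hc Z hZ), superposition_apply (hc Y hY), dist_eq_norm]
  refine (H k _ ?_).le
  rw [← dist_eq_norm]
  exact (ContinuousMap.dist_apply_le_dist k).trans_lt hZY

variable [NormedSpace ℝ E] [NormedSpace ℝ F]

/-- Pointwise application of a continuous family of operators to a continuous function. -/
def pointwiseApply : C(K, E →L[ℝ] F) →L[ℝ] C(K, E) →L[ℝ] C(K, F) :=
  LinearMap.mkContinuous₂
    (LinearMap.mk₂ ℝ (fun (A : C(K, E →L[ℝ] F)) (Y : C(K, E)) =>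
        (⟨fun k => A k (Y k), by fun_prop⟩ : C(K, F)))
      (fun _ _ _ => by ext; simp) (fun _ _ _ => by ext; simp)
      (fun _ _ _ => by ext; simp) (fun _ _ _ => by ext; simp)) 1
    fun A Y => by
      rw [one_mul]
      refine (ContinuousMap.norm_le _ (by positivity)).2 fun k => ?_
      exact ((A k).le_opNorm _).trans
        (by gcongr; exacts [A.norm_coe_le_norm k, Y.norm_coe_le_norm k])

@[simp]
theorem pointwiseApply_apply (A : C(K, E →L[ℝ] F)) (Y : C(K, E)) (k : K) :
    pointwiseApply A Y k = A k (Y k) := rfl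

theorem hasFDerivAt_superposition {X : E → F} {X' : E → E →L[ℝ] F} {V : Set E} (hV : IsOpen V)
    (hd : ∀ x ∈ V, HasFDerivAt X (X' x) x) (hX' : ContinuousOn X' V)
    {Y : C(K, E)} (hY : ∀ k, Y k ∈ V) :
    HasFDerivAt (superposition X : C(K, E) → C(K, F)) (pointwiseApply (superposition X' Y)) Y := by
  have hc : ∀ Z : C(K, E), (∀ k, Z k ∈ V) → ∀ k, ContinuousAt X (Z k) :=
    fun Z hZ k => (hd _ (hZ k)).continuousAt
  have hc' : ∀ k, ContinuousAt X' (Y k) := fun k => hX'.continuousAt (hV.mem_nhds (hY k))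
  rw [hasFDerivAt_iff_isLittleO, Asymptotics.isLittleO_iff]
  intro ε hε
  obtain ⟨δ, hδ, H⟩ := exists_forall_norm_sub_lt hc' hε
  obtain ⟨ρ, hρ, hball⟩ : ∃ ρ > 0, ∀ k, Metric.ball (Y k) ρ ⊆ V := by
    obtain ⟨ρ, hρ, h⟩ := (isCompact_range (map_continuous Y)).exists_thickening_subset_open hV
      (by rintro _ ⟨k, rfl⟩; exact hY k)
    exact ⟨ρ, hρ, fun k => (Metric.ball_subset_thickening (mem_range_self k) ρ).trans h⟩
  filter_upwards [(isOpen_forall_mem hV).mem_nhds hY,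
    Metric.ball_mem_nhds Y (lt_min hδ hρ)] with Z hZ hZY
  refine (ContinuousMap.norm_le _ (by positivity)).2 fun k => ?_
  rw [ContinuousMap.sub_apply, ContinuousMap.sub_apply, superposition_apply (hc Z hZ),
    superposition_apply (hc Y hY), pointwiseApply_apply, superposition_apply hc',
    ContinuousMap.sub_apply]
  have hzk : Z k ∈ Metric.ball (Y k) (min δ ρ) :=
    (ContinuousMap.dist_apply_le_dist k).trans_lt hZY
  have hb := (convex_ball (Y k) (min δ ρ)).norm_image_sub_le_of_norm_hasFDerivWithin_le'
    (f := X) (f' := X') (φ := X' (Y k)) (C := ε)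
    (fun x hx => (hd x (hball k
      (Metric.ball_subset_ball (min_le_right _ _) hx))).hasFDerivWithinAt)
    (fun x hx => (H k x (by
      rw [← dist_eq_norm]; exact (Metric.mem_ball.1 hx).trans_le (min_le_left _ _))).le)
    (Metric.mem_ball_self (lt_min hδ hρ)) hzk
  exact hb.trans (mul_le_mul_of_nonneg_left ((Z - Y).norm_coe_le_norm k) hε.le)

theorem contDiffAt_superposition {X : E → F} {Y : C(K, E)} {x : E} (hY : ∀ k, Y k = x)
    (hX : ContDiffAt ℝ 1 X x) :
    ContDiffAt ℝ 1 (superposition X : C(K, E) → C(K, F)) Y := by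
  obtain ⟨X', u, hu, hc, hd⟩ := contDiffAt_one_iff.1 hX
  obtain ⟨V, hVu, hV, hxV⟩ := mem_nhds_iff.1 hu
  refine contDiffAt_one_iff.2 ⟨fun Y => pointwiseApply (superposition X' Y), {Y | ∀ k, Y k ∈ V},
    (isOpen_forall_mem hV).mem_nhds fun k => by rwa [hY k], ?_, fun Z hZ =>
      hasFDerivAt_superposition hV (fun x hx => hd x (hVu hx)) (hc.mono hVu) hZ⟩
  exact pointwiseApply.continuous.comp_continuousOn
    (continuousOn_superposition hV (hc.mono hVu))

end Superposition

/-! ### The local flow of a vector field of class `C¹` -/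

section Flow

variable {E : Type*} [NormedAddCommGroup E] [NormedSpace ℝ E]

/-- The primitive `τ ↦ ∫₀^τ Y` of a continuous function on `[0, 1]`. -/
def primitive : C(Icc (0 : ℝ) 1, E) →L[ℝ] C(Icc (0 : ℝ) 1, E) :=
  have hint : ∀ (Y : C(Icc (0 : ℝ) 1, E)) (a b : ℝ), IntervalIntegrable
      (fun σ => Y (projIcc 0 1 zero_le_one σ)) volume a b := fun Y a b =>
    (Y.continuous.comp continuous_projIcc).intervalIntegrable a b
  LinearMap.mkContinuous
    { toFun := fun Y => ⟨fun τ => ∫ σ in (0 : ℝ)..τ, Y (projIcc 0 1 zero_le_one σ),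
        (intervalIntegral.continuous_primitive (hint Y) 0).comp continuous_subtype_val⟩
      map_add' := fun Y Z => by
        ext τ
        simpa using intervalIntegral.integral_add (hint Y 0 τ) (hint Z 0 τ)
      map_smul' := fun c Y => by
        ext τ
        simp } 1
    fun Y => by
      refine (ContinuousMap.norm_le _ (by positivity)).2 fun τ => ?_
      have h := intervalIntegral.norm_integral_le_of_norm_le_const (a := 0) (b := (τ : ℝ))
        (C := ‖Y‖) (f := fun σ => Y (projIcc 0 1 zero_le_one σ))
        fun σ _ => Y.norm_coe_le_norm _
      refine h.trans ?_
      rw [one_mul, sub_zero, abs_of_nonneg τ.2.1]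
      exact mul_le_of_le_one_right (norm_nonneg _) τ.2.2

theorem primitive_apply (Y : C(Icc (0 : ℝ) 1, E)) (τ : Icc (0 : ℝ) 1) :
    primitive Y τ = ∫ σ in (0 : ℝ)..τ, Y (projIcc 0 1 zero_le_one σ) := rfl

/-- The map whose zeros `((t, x), Y)` are the integral curves `Y` of the vector field `t • X` on
`[0, 1]` that start at `x`. -/
def integralCurveDefect (X : E → E) (q : (ℝ × E) × C(Icc (0 : ℝ) 1, E)) : C(Icc (0 : ℝ) 1, E) :=
  q.2 - ContinuousLinearMap.const ℝ _ q.1.2 - q.1.1 • primitive (superposition X q.2)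

variable [CompleteSpace E]

/-- A vector field of class `C¹` has a local flow that is of class `C¹` jointly in time and in the
initial point. The curve `τ ↦ α(τ t)`, where `α` is the integral curve starting at `x`, solves an
equation in `C([0, 1], E)` to which the implicit function theorem applies; the parameters of this
equation are `t` and `x`. -/
theorem ContDiffAt.exists_contDiffAt_flow {X : E → E} {x₀ : E} (hX : ContDiffAt ℝ 1 X x₀) :
    ∃ φ : ℝ × E → E, ContDiffAt ℝ 1 φ (0, x₀) ∧
      ∀ᶠ p in 𝓝 ((0 : ℝ), x₀), φ (0, p.2) = p.2 ∧
        HasDerivAt (fun t => φ (t, p.2)) (X (φ p)) p.1 := by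
  obtain ⟨ε, hε, a, r, L, K, hr, hpl⟩ := IsPicardLindelof.of_contDiffAt_one hX
  obtain ⟨α, hα, hcont⟩ := (hpl 0).exists_forall_mem_closedBall_eq_hasDerivWithinAt_continuousOn
  simp only [zero_sub, zero_add] at hα hcont
  have hbox : Metric.closedBall x₀ r ×ˢ Icc (-ε) ε ∈ 𝓝 (x₀, (0 : ℝ)) :=
    prod_mem_nhds (Metric.closedBall_mem_nhds x₀ (by exact_mod_cast hr))
      (Icc_mem_nhds (by linarith) hε)
  have hα₀ : α (x₀, 0) = x₀ := (hα x₀ (Metric.mem_closedBall_self r.2)).1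
  let c₀ : C(Icc (0 : ℝ) 1, E) := ContinuousMap.const _ x₀
  let G := integralCurveDefect X
  have hsup : ContDiffAt ℝ 1 (superposition X : C(Icc (0 : ℝ) 1, E) → _) c₀ :=
    contDiffAt_superposition (fun _ => rfl) hX
  have hG : ContDiffAt ℝ 1 G ((0, x₀), c₀) := by
    have h2 : ContDiffAt ℝ 1 (fun q : (ℝ × E) × C(Icc (0 : ℝ) 1, E) => superposition X q.2)
        ((0, x₀), c₀) := ContDiffAt.comp (g := superposition X) _ hsup contDiffAt_snd
    have h3 := (primitive (E := E)).contDiff.contDiffAt.comp _ h2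
    refine (contDiffAt_snd.sub ?_).sub (ContDiffAt.smul
      (contDiff_fst.comp contDiff_fst).contDiffAt h3)
    exact (ContinuousLinearMap.const ℝ (Icc (0 : ℝ) 1) : E →L[ℝ] _).contDiff.contDiffAt.comp _
      (contDiff_snd.comp contDiff_fst).contDiffAt
  -- at `t = 0` the defect is `Y - x`, so its partial derivative in `Y` is the identity
  have hinv : (fderiv ℝ G ((0, x₀), c₀) ∘L .inr ℝ (ℝ × E) C(Icc (0 : ℝ) 1, E)).IsInvertible := by
    have h1 := (hG.differentiableAt one_ne_zero).hasFDerivAt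
    have h2 := HasFDerivAt.comp c₀ h1 (hasFDerivAt_prodMk_right (𝕜 := ℝ) (0, x₀) c₀)
    have h3 : HasFDerivAt (G ∘ fun Y => ((0, x₀), Y)) (.id ℝ _) c₀ := by
      have : (G ∘ fun Y => (((0 : ℝ), x₀), Y)) =
          fun Y => Y - ContinuousLinearMap.const ℝ _ x₀ := by
        ext1 Y
        simp [G, integralCurveDefect]
      rw [this]
      exact (hasFDerivAt_id c₀).sub_const _
    rw [h2.unique h3]
    exact ⟨.refl ℝ _, rfl⟩
  let ψ := hG.implicitFunction one_ne_zero hinv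
  have hψ : ContDiffAt ℝ 1 ψ (0, x₀) := hG.contDiffAt_implicitFunction one_ne_zero hinv
  -- the curve `τ ↦ α(τ t)`, continuous for small `t`
  let Y : ℝ × E → C(Icc (0 : ℝ) 1, E) := fun p =>
    ContinuousMap.mkD (fun τ : Icc (0 : ℝ) 1 => α (p.2, τ * p.1)) c₀
  have hmem : ∀ t ∈ Icc (-ε) ε, ∀ τ ∈ Icc (0 : ℝ) 1, τ * t ∈ Icc (-ε) ε := by
    intro t ht τ hτ
    rw [mem_Icc, ← abs_le] at ht ⊢
    rw [abs_mul, abs_of_nonneg hτ.1]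
    exact (mul_le_of_le_one_left (abs_nonneg t) hτ.2).trans ht
  have hYapp : ∀ p : ℝ × E, p.1 ∈ Icc (-ε) ε → p.2 ∈ Metric.closedBall x₀ (r : ℝ) →
      ∀ τ, Y p τ = α (p.2, τ * p.1) := by
    intro p h1 h2 τ
    refine ContinuousMap.mkD_apply_of_continuous
      (hcont.comp_continuous (by fun_prop) fun σ => ⟨h2, hmem _ h1 _ σ.2⟩)
  have hbox' : ∀ᶠ p : ℝ × E in 𝓝 (0, x₀),
      p.1 ∈ Icc (-ε) ε ∧ p.2 ∈ Metric.closedBall x₀ (r : ℝ) :=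
    prod_mem_nhds (Icc_mem_nhds (by linarith) hε)
      (Metric.closedBall_mem_nhds x₀ (by exact_mod_cast hr))
  have hYt : Tendsto Y (𝓝 (0, x₀)) (𝓝 c₀) := by
    rw [Metric.tendsto_nhds]
    intro δ hδ
    have h := Metric.continuousAt_iff'.1 (hcont.continuousAt hbox) _ (half_pos hδ)
    obtain ⟨ρ, hρ, h⟩ := Metric.eventually_nhds_iff_ball.1 h
    filter_upwards [hbox', Metric.ball_mem_nhds (0, x₀) hρ] with p hp hp'
    refine lt_of_le_of_lt ((ContinuousMap.dist_le (half_pos hδ).le).2 fun τ => ?_)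
      (half_lt_self hδ)
    rw [hYapp p hp.1 hp.2, ContinuousMap.const_apply]
    rw [Metric.mem_ball, Prod.dist_eq, max_lt_iff] at hp'
    have := h (p.2, τ * p.1) (by
      rw [Metric.mem_ball, Prod.dist_eq, max_lt_iff]
      refine ⟨hp'.2, ?_⟩
      rw [dist_zero_right, norm_mul, Real.norm_of_nonneg τ.2.1]
      refine (mul_le_of_le_one_left (norm_nonneg _) τ.2.2).trans_lt ?_
      simpa using hp'.1)
    rw [hα₀] at this
    exact this.le
  have hXc : ∀ᶠ z in 𝓝 x₀, ContinuousAt X z := by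
    filter_upwards [hX.eventually (by simp)] with z hz using hz.continuousAt
  obtain ⟨V, hVX, hV, hxV⟩ := mem_nhds_iff.1 hXc
  have hYV : ∀ᶠ p in 𝓝 (0, x₀), ∀ τ, Y p τ ∈ V :=
    hYt.eventually ((isOpen_forall_mem hV).mem_nhds fun _ => hxV)
  have hGY : ∀ᶠ p in 𝓝 (0, x₀), G (p, Y p) = 0 := by
    filter_upwards [hbox', hYV] with p hp hpV
    ext τ
    obtain ⟨hα1, hα2⟩ := hα p.2 hp.2
    have hd : ∀ σ ∈ Icc (0 : ℝ) τ, HasDerivWithinAt (fun σ => α (p.2, σ * p.1))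
        (p.1 • X (Y p (projIcc 0 1 zero_le_one σ))) (Icc (0 : ℝ) τ) σ := by
      intro σ hσ
      have hσ' : σ ∈ Icc (0 : ℝ) 1 := ⟨hσ.1, hσ.2.trans τ.2.2⟩
      rw [projIcc_of_mem _ hσ', hYapp p hp.1 hp.2]
      refine (hα2 _ (hmem _ hp.1 σ hσ')).scomp σ
        (h := fun σ => σ * p.1) (hasDerivAt_mul_const p.1).hasDerivWithinAt ?_
      exact fun σ' h => hmem _ hp.1 _ ⟨h.1, h.2.trans τ.2.2⟩
    have hXY : Continuous fun σ => X (Y p (projIcc 0 1 zero_le_one σ)) :=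
      continuous_iff_continuousAt.2 fun σ => ContinuousAt.comp (g := X) (hVX (hpV _))
        ((Y p).continuous.comp continuous_projIcc).continuousAt
    have hint := intervalIntegral.integral_eq_sub_of_hasDeriv_right_of_le τ.2.1
      (fun σ hσ => (hd σ hσ).continuousWithinAt)
      (fun σ hσ => (hd σ (Ioo_subset_Icc_self hσ)).hasDerivAt
        (Icc_mem_nhds hσ.1 hσ.2) |>.hasDerivWithinAt)
      ((hXY.const_smul p.1).intervalIntegrable 0 τ)
    rw [intervalIntegral.integral_smul, zero_mul, hα1] at hint
    have hs : ∀ σ : ℝ, superposition X (Y p) (projIcc 0 1 zero_le_one σ)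
        = X (Y p (projIcc 0 1 zero_le_one σ)) :=
      fun σ => superposition_apply (fun k => hVX (hpV k)) _
    simp only [G, integralCurveDefect, ContinuousMap.sub_apply, ContinuousMap.smul_apply,
      primitive_apply, hs, hint]
    simp [hYapp p hp.1 hp.2]
  have hG₀ : G ((0, x₀), c₀) = 0 := by
    ext τ
    simp [G, integralCurveDefect, c₀]
  -- `Y p` is close to `c₀` and is a zero of the defect, hence it is the implicit function
  have hψY : ∀ᶠ p in 𝓝 (0, x₀), ψ p = Y p := by
    have h := (tendsto_id.prodMk_nhds hYt).eventually
      (hG.eventually_apply_eq_iff_implicitFunction one_ne_zero hinv)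
    filter_upwards [h, hGY] with p h1 h2
    exact h1.1 (by rw [hG₀]; exact h2)
  -- the curve at `τ = 1` is `α t`, and evaluation at `1` is continuous and linear
  let e₁ : C(Icc (0 : ℝ) 1, E) →L[ℝ] E := ContinuousMap.evalCLM ℝ ⟨1, by simp⟩
  have hev : ∀ᶠ p : ℝ × E in 𝓝 (0, x₀), e₁ (ψ p) = α (p.2, p.1) := by
    filter_upwards [hψY, hbox'] with p h1 h2
    rw [h1]
    exact (hYapp p h2.1 h2.2 ⟨1, by simp⟩).trans (by simp)
  refine ⟨fun p => e₁ (ψ p), e₁.contDiff.contDiffAt.comp _ hψ, ?_⟩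
  have htz : Tendsto (fun p : ℝ × E => ((0 : ℝ), p.2)) (𝓝 (0, x₀)) (𝓝 (0, x₀)) :=
    Continuous.tendsto' (by fun_prop) _ _ rfl
  have hIoo : ∀ᶠ p : ℝ × E in 𝓝 (0, x₀), p.1 ∈ Ioo (-ε) ε :=
    continuous_fst.continuousAt.eventually (Ioo_mem_nhds (by simpa using hε) hε)
  filter_upwards [htz.eventually hev, hbox', hIoo, hev, eventually_eventually_nhds.2 hev]
    with p h1 h2 h3 h4 h5
  refine ⟨h1.trans (hα p.2 h2.2).1, ?_⟩
  have hd := ((hα p.2 h2.2).2 p.1 h2.1).hasDerivAt (Icc_mem_nhds h3.1 h3.2)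
  rw [← h4] at hd
  refine hd.congr_of_eventuallyEq ?_
  exact (Continuous.tendsto' (f := fun t : ℝ => (t, p.2)) (by fun_prop) p.1 p rfl).eventually h5

end Flow

/-! ### Fourier series of real continuous functions on the circle -/

open ComplexConjugate

/-- A real continuous function on the circle, regarded as a complex one. -/
def complexify (u : C(UnitAddCircle, ℝ)) : C(UnitAddCircle, ℂ) := ⟨fun x => (u x : ℂ), by fun_prop⟩

@[simp]
theorem complexify_apply (u : C(UnitAddCircle, ℝ)) (x : UnitAddCircle) :
    complexify u x = (u x : ℂ) := rfl

theorem norm_le_norm_complexify (u : C(UnitAddCircle, ℝ)) : ‖u‖ ≤ ‖complexify u‖ :=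
  (ContinuousMap.norm_le _ (norm_nonneg _)).2 fun x => by
    simpa using (complexify u).norm_coe_le_norm x

/-- The `n`-th Fourier coefficient of a complex continuous function. -/
def fourierCoeffCLM (n : ℤ) : C(UnitAddCircle, ℂ) →L[ℂ] ℂ :=
  have hint : ∀ f : C(UnitAddCircle, ℂ),
      Integrable (fun x => fourier (-n) x • f x) AddCircle.haarAddCircle := fun f =>
    Continuous.integrable_of_hasCompactSupport (by fun_prop) (.of_compactSpace _)
  LinearMap.mkContinuous
    { toFun := fun f => fourierCoeff f n
      map_add' := fun f g => by
        simpa [fourierCoeff, mul_add] using integral_add (hint f) (hint g)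
      map_smul' := fun c f => fourierCoeff.const_smul f c n } 1
    fun f => by
      refine (norm_integral_le_of_norm_le_const (C := ‖f‖) (.of_forall fun x => ?_)).trans ?_
      · rw [norm_smul, fourier_apply, Circle.norm_coe, one_mul]
        exact f.norm_coe_le_norm x
      · simp

theorem fourierCoeffCLM_apply (n : ℤ) (f : C(UnitAddCircle, ℂ)) :
    fourierCoeffCLM n f = fourierCoeff f n := rfl

theorem fourierCoeffCLM_complexify (n : ℤ) (u : C(UnitAddCircle, ℝ)) :
    fourierCoeffCLM n (complexify u) = realFourierCoeff u n := rfl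

theorem fourierCoeffCLM_fourier (n k : ℤ) :
    fourierCoeffCLM n (fourier k) = if k = n then 1 else 0 := by
  rw [fourierCoeffCLM_apply, fourierCoeff_fourier, Pi.single_apply]
  simp [eq_comm]

theorem fourierCoeffCLM_fourier_mul (n k : ℤ) (f : C(UnitAddCircle, ℂ)) :
    fourierCoeffCLM n (fourier k * f) = fourierCoeffCLM (n - k) f := by
  simp only [fourierCoeffCLM_apply, fourierCoeff]
  refine integral_congr_ae (.of_forall fun x => ?_)
  have : -(n - k) = -n + k := by ring
  simp only [this, smul_eq_mul, ContinuousMap.mul_apply]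
  rw [fourier_add]
  ring

theorem realFourierCoeff_neg (u : UnitAddCircle → ℝ) (n : ℤ) :
    realFourierCoeff u (-n) = conj (realFourierCoeff u n) := by
  simp only [realFourierCoeff, fourierCoeff]
  rw [← integral_conj]
  refine integral_congr_ae (.of_forall fun x => ?_)
  simp only [smul_eq_mul, map_mul, Complex.conj_ofReal]
  rw [← fourier_neg]

theorem realFourierCoeff_const (c : ℝ) (n : ℤ) :
    realFourierCoeff (fun _ => c) n = if n = 0 then (c : ℂ) else 0 := by
  have h1 : (⟨fun _ => (c : ℂ), continuous_const⟩ : C(UnitAddCircle, ℂ)) = (c : ℂ) • fourier 0 := by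
    ext x
    simp
  have h2 := congrArg (fourierCoeffCLM n) h1
  rw [map_smul, fourierCoeffCLM_fourier] at h2
  refine h2.trans ?_
  by_cases h : n = 0 <;> simp [h, eq_comm]

theorem eq_of_realFourierCoeff_eq {u v : C(UnitAddCircle, ℝ)}
    (h : ∀ n, realFourierCoeff u n = realFourierCoeff v n) : u = v := by
  have h1 : u + (-1 : ℝ) • v = 0 := eq_zero_of_realFourierCoeff _ fun n => by
    rw [realFourierCoeff_add, realFourierCoeff_smul, h]
    push_cast
    ring
  rw [neg_one_smul, ← sub_eq_add_neg] at h1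
  exact sub_eq_zero.1 h1

/-- An absolutely summable conjugate-symmetric sequence is the sequence of Fourier coefficients of
a real continuous function. -/
theorem exists_realFourierCoeff_eq {c : ℤ → ℂ} (hc : Summable fun n => ‖c n‖)
    (hconj : ∀ n, c (-n) = conj (c n)) :
    ∃ u : C(UnitAddCircle, ℝ), ∀ n, realFourierCoeff u n = c n := by
  have hs : Summable fun n => c n • (fourier n : C(UnitAddCircle, ℂ)) :=
    .of_norm (by simpa [norm_smul, fourier_norm] using hc)
  set F : C(UnitAddCircle, ℂ) := ∑' n, c n • fourier n with hF
  have hFx : ∀ x, HasSum (fun n => c n * fourier n x) (F x) := fun x =>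
    (ContinuousMap.evalCLM ℂ x).hasSum hs.hasSum
  have hreal : ∀ x, conj (F x) = F x := fun x => by
    have h1 := Complex.hasSum_conj'.2 (hFx x)
    rw [← (Equiv.neg ℤ).hasSum_iff] at h1
    refine h1.unique ((hFx x).congr_fun ?_)
    intro n
    simp only [Function.comp_apply, Equiv.neg_apply, map_mul, hconj, fourier_neg, Complex.conj_conj]
  refine ⟨⟨fun x => (F x).re, by fun_prop⟩, fun n => ?_⟩
  rw [← fourierCoeffCLM_complexify]
  have hFc : complexify ⟨fun x => (F x).re, by fun_prop⟩ = F := by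
    ext x
    exact Complex.conj_eq_iff_re.1 (hreal x)
  have h2 := (fourierCoeffCLM n).hasSum hs.hasSum
  simp only [map_smul, fourierCoeffCLM_fourier, smul_eq_mul, mul_ite, mul_one, mul_zero] at h2
  rw [hFc]
  refine h2.unique ((hasSum_ite_eq n (c n)).congr_fun fun k => ?_)
  split_ifs with h <;> simp [h]

/-! ### The weights and the norm of the Sobolev spaces -/

/-- The Sobolev weight `(1 + n²)^(r/2)`. -/
def sobolevWeight (r : ℝ) (n : ℤ) : ℝ := (1 + (n : ℝ) ^ 2) ^ (r / 2)

theorem sobolevWeight_pos (r : ℝ) (n : ℤ) : 0 < sobolevWeight r n := by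
  unfold sobolevWeight; positivity

theorem sobolevWeight_neg (r : ℝ) (n : ℤ) : sobolevWeight r (-n) = sobolevWeight r n := by
  simp [sobolevWeight]

theorem sobolevWeight_mono {r r' : ℝ} (h : r ≤ r') (n : ℤ) :
    sobolevWeight r n ≤ sobolevWeight r' n :=
  Real.rpow_le_rpow_of_exponent_le (by nlinarith [sq_nonneg (n : ℝ)]) (by linarith)

theorem sobolevWeight_add (r r' : ℝ) (n : ℤ) :
    sobolevWeight (r + r') n = sobolevWeight r n * sobolevWeight r' n := by
  rw [sobolevWeight, sobolevWeight, sobolevWeight, ← Real.rpow_add (by positivity)]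
  congr 1; ring

theorem sobolevWeight_one (n : ℤ) : sobolevWeight 1 n = √(1 + (n : ℝ) ^ 2) := by
  rw [sobolevWeight, Real.sqrt_eq_rpow]

/-- The weights are quasi-subadditive, which makes `H^r` an algebra for `r > 1/2`. -/
theorem sobolevWeight_le_add {r : ℝ} (hr : 0 ≤ r) (k l : ℤ) :
    sobolevWeight r (k + l) ≤ 4 ^ (r / 2) * (sobolevWeight r k + sobolevWeight r l) := by
  unfold sobolevWeight
  have key : ∀ x y : ℝ, y ^ 2 ≤ x ^ 2 →
      (1 + (x + y) ^ 2) ^ (r / 2) ≤ 4 ^ (r / 2) * (1 + x ^ 2) ^ (r / 2) := by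
    intro x y h
    rw [← Real.mul_rpow (by norm_num) (by positivity)]
    exact Real.rpow_le_rpow (by positivity) (by nlinarith [sq_nonneg (x - y)]) (by linarith)
  push_cast
  have hk : 0 ≤ (4 : ℝ) ^ (r / 2) * (1 + (k : ℝ) ^ 2) ^ (r / 2) := by positivity
  have hl : 0 ≤ (4 : ℝ) ^ (r / 2) * (1 + (l : ℝ) ^ 2) ^ (r / 2) := by positivity
  rcases le_total ((l : ℝ) ^ 2) ((k : ℝ) ^ 2) with h | h
  · linarith [key k l h]
  · have := key l k h
    rw [add_comm (l : ℝ)] at this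
    linarith

theorem memℓp_inv_sobolevWeight {r : ℝ} (hr : 1 / 2 < r) :
    Memℓp (fun n : ℤ => (sobolevWeight r n)⁻¹) 2 := by
  refine memℓp_gen ?_
  have hs : Summable fun n : ℤ => |(n : ℝ)| ^ (-(2 * r)) := Real.summable_abs_int_rpow (by linarith)
  have hs1 : Summable fun n : ℤ => |(n : ℝ)| ^ (-(2 * r)) + if n = 0 then 1 else 0 :=
    hs.add (hasSum_ite_eq 0 1).summable
  refine Summable.of_nonneg_of_le (fun n => by positivity) (fun n => ?_) hs1
  have hpos : (0 : ℝ) < 1 + (n : ℝ) ^ 2 := by positivity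
  have h2 : ‖(sobolevWeight r n)⁻¹‖ ^ (2 : ENNReal).toReal = (1 + (n : ℝ) ^ 2) ^ (-r) := by
    rw [Real.norm_of_nonneg (inv_nonneg.2 (sobolevWeight_pos r n).le), sobolevWeight,
      ← Real.rpow_neg hpos.le, ← Real.rpow_mul hpos.le]
    congr 1; simp
  rw [h2]
  by_cases hn : n = 0
  · subst hn
    have : -(2 * r) ≠ 0 := by intro h; linarith
    simp [Real.zero_rpow this]
  · have hn' : (0 : ℝ) < |(n : ℝ)| := by positivity
    rw [if_neg hn, add_zero, show -(2 * r) = 2 * (-r) by ring, Real.rpow_mul hn'.le]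
    refine Real.rpow_le_rpow_of_nonpos (by positivity) ?_ (by linarith)
    simp

/-- The `ℓ²` norm of the inverse weights, which bounds the `ℓ¹` norm of the Fourier coefficients
by the norm of `H^r`. -/
def sobolevConst (r : ℝ) : ℝ := √(∑' n : ℤ, ((sobolevWeight r n)⁻¹) ^ 2)

theorem summable_norm_of_weighted {r : ℝ} (hr : 1 / 2 < r) (a : lp (fun _ : ℤ => ℂ) 2)
    {c : ℤ → ℂ} (h : ∀ n, a n = sobolevWeight r n * c n) :
    (Summable fun n => ‖c n‖) ∧ ∑' n, ‖c n‖ ≤ sobolevConst r * ‖a‖ := by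
  let b : lp (fun _ : ℤ => ℝ) 2 := ⟨_, memℓp_inv_sobolevWeight hr⟩
  have hb : ∀ n, b n = (sobolevWeight r n)⁻¹ := fun n => rfl
  have hbn : ‖b‖ = sobolevConst r := by
    rw [lp.norm_eq_tsum_rpow (by simp), sobolevConst, Real.sqrt_eq_rpow]
    simp [hb]
  have hconj : (2 : ENNReal).toReal.HolderConjugate (2 : ENNReal).toReal := by
    simpa using Real.HolderConjugate.two_two
  have hc : ∀ n, ‖b n‖ * ‖a n‖ = ‖c n‖ := fun n => by
    have := sobolevWeight_pos r n
    rw [h, hb, norm_mul, Complex.norm_real, ← mul_assoc, ← norm_mul,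
      inv_mul_cancel₀ this.ne', norm_one, one_mul]
  have := lp.tsum_mul_le_mul_norm hconj b (lp.toNorm a)
  simpa only [lp.toNorm_coe, norm_norm, hc, hbn, lp.norm_toNorm] using this

namespace Hs

variable {r r' : ℝ}

/-- The Fourier coefficients of an element of `H^r`. -/
def coeff (u : Hs r) (n : ℤ) : ℂ := realFourierCoeff u n

theorem coeff_def (u : Hs r) (n : ℤ) : u.coeff n = realFourierCoeff u n := rfl

@[simp]
theorem coeff_add (u v : Hs r) (n : ℤ) : (u + v).coeff n = u.coeff n + v.coeff n :=
  realFourierCoeff_add u.toCont v.toCont n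

@[simp]
theorem coeff_smul (c : ℝ) (u : Hs r) (n : ℤ) : (c • u).coeff n = c * u.coeff n :=
  realFourierCoeff_smul c u.toCont n

theorem coeff_neg (u : Hs r) (n : ℤ) : u.coeff (-n) = conj (u.coeff n) :=
  realFourierCoeff_neg u n

theorem toEll2_apply (u : Hs r) (n : ℤ) : toEll2 r u n = sobolevWeight r n * u.coeff n := rfl

theorem norm_eq (u : Hs r) : ‖u‖ = ‖toEll2 r u‖ := rfl

theorem isometry_toEll2 : Isometry (toEll2 r) :=
  AddMonoidHomClass.isometry_of_norm _ fun _ => rfl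

theorem ext_coeff {u v : Hs r} (h : ∀ n, u.coeff n = v.coeff n) : u = v :=
  toEll2_injective r (lp.ext (funext fun n => by rw [toEll2_apply, toEll2_apply, h]))

theorem norm_le_of_coeff {u : Hs r} {a : lp (fun _ : ℤ => ℝ) 2}
    (h : ∀ n, sobolevWeight r n * ‖u.coeff n‖ ≤ a n) : ‖u‖ ≤ ‖a‖ := by
  rw [norm_eq]
  refine lp.norm_mono two_ne_zero fun n => ?_
  rw [toEll2_apply, norm_mul, Complex.norm_real, Real.norm_of_nonneg (sobolevWeight_pos r n).le]
  exact (h n).trans (Real.le_norm_self _)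

theorem exists_coeff_eq (hr : 1 / 2 < r) {c : ℤ → ℂ} (hconj : ∀ n, c (-n) = conj (c n))
    (hm : Memℓp (fun n => (sobolevWeight r n : ℂ) * c n) 2) : ∃ u : Hs r, u.coeff = c := by
  obtain ⟨u, hu⟩ := exists_realFourierCoeff_eq
    (summable_norm_of_weighted hr ⟨_, hm⟩ fun _ => rfl).1 hconj
  have hu' : realFourierCoeff u = c := funext hu
  refine ⟨⟨u, ?_⟩, hu'⟩
  change Memℓp (fun n => (sobolevWeight r n : ℂ) * realFourierCoeff u n) 2
  rwa [hu']

theorem completeSpace (hr : 1 / 2 < r) : CompleteSpace (Hs r) := by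
  have hrange : range (toEll2 r) = ⋂ n : ℤ, {a | a (-n) = conj (a n)} := by
    ext a
    simp only [mem_range, mem_iInter, mem_ofPred_eq]
    constructor
    · rintro ⟨u, rfl⟩ n
      simp [toEll2_apply, sobolevWeight_neg, coeff_neg]
    · intro h
      have hw : ∀ n, (sobolevWeight r n : ℂ) ≠ 0 := fun n => by
        exact_mod_cast (sobolevWeight_pos r n).ne'
      obtain ⟨u, hu⟩ := exists_coeff_eq (r := r) hr
        (c := fun n => (sobolevWeight r n : ℂ)⁻¹ * a n)
        (fun n => by simp [sobolevWeight_neg, h]) (by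
          simpa only [mul_inv_cancel_left₀ (hw _)] using lp.memℓp a)
      refine ⟨u, lp.ext (funext fun n => ?_)⟩
      rw [toEll2_apply, hu, mul_inv_cancel_left₀ (hw n)]
  have hclosed : IsClosed (range (toEll2 r)) := by
    rw [hrange]
    refine isClosed_iInter fun n => isClosed_eq ?_ ?_
    · exact (lp.evalCLM ℂ (fun _ : ℤ => ℂ) 2 (-n)).continuous
    · exact Complex.continuous_conj.comp (lp.evalCLM ℂ (fun _ : ℤ => ℂ) 2 n).continuous
  exact (completeSpace_iff_isComplete_range isometry_toEll2.isUniformInducing).2 hclosed.isComplete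

/-! ### Fourier multipliers -/

/-- The Fourier multiplier `H^r → H^r'` with the conjugate-symmetric symbol `m`. -/
def multiplier (hr' : 1 / 2 < r') (m : ℤ → ℂ) (hconj : ∀ n, m (-n) = conj (m n)) (C : ℝ)
    (hC : ∀ n, sobolevWeight r' n * ‖m n‖ ≤ C * sobolevWeight r n) : Hs r →L[ℝ] Hs r' :=
  have hC0 : 0 ≤ C := by
    have h1 := hC 0
    have h2 : (0 : ℝ) ≤ sobolevWeight r' 0 * ‖m 0‖ :=
      mul_nonneg (sobolevWeight_pos _ _).le (norm_nonneg _)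
    exact nonneg_of_mul_nonneg_left (h2.trans h1) (sobolevWeight_pos r 0)
  have hb : ∀ (u : Hs r) n, sobolevWeight r' n * ‖m n * u.coeff n‖ ≤ C * ‖toEll2 r u n‖ := by
    intro u n
    rw [norm_mul, ← mul_assoc, toEll2_apply, norm_mul, Complex.norm_real,
      Real.norm_of_nonneg (sobolevWeight_pos r n).le, ← mul_assoc]
    exact mul_le_mul_of_nonneg_right (hC n) (norm_nonneg _)
  have hex : ∀ u : Hs r, ∃ v : Hs r', v.coeff = fun n => m n * u.coeff n := fun u =>
    exists_coeff_eq hr' (fun n => by simp [hconj, coeff_neg])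
      (Memℓp.mono ((lp.memℓp (toEll2 r u)).norm.const_mul C) fun n => by
        rw [norm_mul, Complex.norm_real, Real.norm_of_nonneg (sobolevWeight_pos r' n).le]
        exact hb u n)
  have hspec : ∀ u n, (hex u).choose.coeff n = m n * u.coeff n := fun u n =>
    congrFun (hex u).choose_spec n
  LinearMap.mkContinuous
    { toFun := fun u => (hex u).choose
      map_add' := fun u v => ext_coeff fun n => (hspec (u + v) n).trans <| by
        rw [coeff_add, coeff_add, hspec, hspec, mul_add]
      map_smul' := fun c u => ext_coeff fun n => (hspec (c • u) n).trans <| by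
        rw [coeff_smul, RingHom.id_apply, coeff_smul, hspec, mul_left_comm] } C
    fun u => by
      have h := norm_le_of_coeff (u := (hex u).choose) (a := C • lp.toNorm (toEll2 r u))
        fun n => by rw [hspec]; exact hb u n
      refine h.trans ((lp.norm_const_smul_le two_ne_zero _ _).trans ?_)
      rw [lp.norm_toNorm, Real.norm_of_nonneg hC0, norm_eq]

@[simp]
theorem coeff_multiplier (hr' : 1 / 2 < r') (m : ℤ → ℂ) (hconj : ∀ n, m (-n) = conj (m n)) (C : ℝ)
    (hC : ∀ n, sobolevWeight r' n * ‖m n‖ ≤ C * sobolevWeight r n) (u : Hs r) (n : ℤ) :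
    (multiplier hr' m hconj C hC u).coeff n = m n * u.coeff n := by
  have h : ∃ v : Hs r', v.coeff = (fun n => m n * u.coeff n) ∧
      multiplier hr' m hconj C hC u = v := by
    refine ⟨_, ?_, rfl⟩
    exact Exists.choose_spec (p := fun v : Hs r' => v.coeff = fun n => m n * u.coeff n) _
  obtain ⟨v, hv, hv'⟩ := h
  rw [hv', hv]

end Hs

/-! ### Integrals over the circle -/

theorem volume_unitAddCircle :
    (volume : Measure UnitAddCircle) = AddCircle.haarAddCircle := by
  rw [AddCircle.volume_eq_smul_haarAddCircle, ENNReal.ofReal_one, one_smul]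

theorem realFourierCoeff_zero (u : UnitAddCircle → ℝ) :
    realFourierCoeff u 0 = (circleMean u : ℂ) := by
  rw [realFourierCoeff, fourierCoeff, circleMean, volume_unitAddCircle, ← integral_complex_ofReal]
  simp

theorem circleMean_const (c : ℝ) : circleMean (fun _ => c) = c := by
  simp [circleMean, volume_unitAddCircle]

/-- The mean of a continuous function. -/
def circleMeanCLM : C(UnitAddCircle, ℝ) →L[ℝ] ℝ :=
  have hint : ∀ f : C(UnitAddCircle, ℝ), Integrable (fun x => f x) := fun f =>
    Continuous.integrable_of_hasCompactSupport (by fun_prop) (.of_compactSpace _)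
  LinearMap.mkContinuous
    { toFun := fun f => circleMean f
      map_add' := fun f g => integral_add (hint f) (hint g)
      map_smul' := fun c f => integral_const_mul c f } 1
    fun f => by
      refine (norm_integral_le_of_norm_le_const (C := ‖f‖)
        (.of_forall fun x => f.norm_coe_le_norm x)).trans ?_
      simp [volume_unitAddCircle]

@[simp]
theorem circleMeanCLM_apply (f : C(UnitAddCircle, ℝ)) : circleMeanCLM f = circleMean f := rfl

/-! ### Convolution of sequences -/

/-- The translate of a square summable sequence. -/
def shiftSeq (a : lp (fun _ : ℤ => ℝ) 2) (k : ℤ) : lp (fun _ : ℤ => ℝ) 2 :=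
  ⟨fun n => a (n - k), memℓp_gen
    (((lp.memℓp a).summable (by simp)).comp_injective (Equiv.subRight k).injective)⟩

theorem norm_shiftSeq (a : lp (fun _ : ℤ => ℝ) 2) (k : ℤ) : ‖shiftSeq a k‖ = ‖a‖ := by
  rw [lp.norm_eq_tsum_rpow (by simp), lp.norm_eq_tsum_rpow (by simp)]
  congr 1
  exact (Equiv.subRight k).tsum_eq fun n => ‖a n‖ ^ (2 : ENNReal).toReal

/-- Young's inequality `‖B * a‖₂ ≤ ‖B‖₁ ‖a‖₂`. -/
theorem exists_hasSum_convolution (a : lp (fun _ : ℤ => ℝ) 2) {B : ℤ → ℝ}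
    (hB : Summable fun k => ‖B k‖) :
    ∃ c : lp (fun _ : ℤ => ℝ) 2, (∀ n, HasSum (fun k => B k * a (n - k)) (c n)) ∧
      ‖c‖ ≤ (∑' k, ‖B k‖) * ‖a‖ := by
  have hn : ∀ k, ‖B k • shiftSeq a k‖ = ‖B k‖ * ‖a‖ := fun k => by
    rw [norm_smul, norm_shiftSeq]
  have hs : Summable fun k => ‖B k • shiftSeq a k‖ := by
    simpa only [hn] using hB.mul_right ‖a‖
  refine ⟨∑' k, B k • shiftSeq a k, fun n => ?_, ?_⟩
  · exact (lp.evalCLM ℝ (fun _ : ℤ => ℝ) 2 n).hasSum hs.of_norm.hasSum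
  · refine (norm_tsum_le_tsum_norm hs).trans ?_
    simp only [hn, tsum_mul_right, le_refl]

namespace Hs

variable {r s : ℝ}

/-! ### Elements of `H^r` as continuous functions -/

@[simp]
theorem toCont_add (u v : Hs r) : (u + v).toCont = u.toCont + v.toCont := rfl

@[simp]
theorem toCont_smul (c : ℝ) (u : Hs r) : (c • u).toCont = c • u.toCont := rfl

@[simp]
theorem toCont_zero : (0 : Hs r).toCont = 0 := rfl

theorem toCont_injective : Function.Injective (toCont : Hs r → C(UnitAddCircle, ℝ)) :=
  Subtype.val_injective

theorem summable_norm_coeff (hr : 1 / 2 < r) (u : Hs r) : Summable fun n => ‖u.coeff n‖ :=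
  (summable_norm_of_weighted hr (toEll2 r u) u.toEll2_apply).1

theorem tsum_norm_coeff_le (hr : 1 / 2 < r) (u : Hs r) :
    ∑' n, ‖u.coeff n‖ ≤ sobolevConst r * ‖u‖ :=
  (summable_norm_of_weighted hr (toEll2 r u) u.toEll2_apply).2

theorem hasSum_fourier (hr : 1 / 2 < r) (u : Hs r) :
    HasSum (fun n => u.coeff n • (fourier n : C(UnitAddCircle, ℂ))) (complexify u.toCont) :=
  hasSum_fourier_series_of_summable (f := complexify u.toCont) (u.summable_norm_coeff hr).of_norm

theorem hasSum_fourier_apply (hr : 1 / 2 < r) (u : Hs r) (x : UnitAddCircle) :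
    HasSum (fun n => u.coeff n * fourier n x) (u x : ℂ) :=
  (ContinuousMap.evalCLM ℂ x).hasSum (u.hasSum_fourier hr)

/-- The Sobolev embedding of `H^r`, `r > 1/2`, into the continuous functions. -/
def toContCLM (hr : 1 / 2 < r) : Hs r →L[ℝ] C(UnitAddCircle, ℝ) :=
  LinearMap.mkContinuous
    { toFun := toCont
      map_add' := toCont_add
      map_smul' := toCont_smul } (sobolevConst r)
    fun u => by
      refine (norm_le_norm_complexify _).trans (le_trans ?_ (u.tsum_norm_coeff_le hr))
      have h : ∀ n, ‖u.coeff n • (fourier n : C(UnitAddCircle, ℂ))‖ = ‖u.coeff n‖ := fun n => by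
        rw [norm_smul, fourier_norm, mul_one]
      have h2 := norm_tsum_le_tsum_norm (f := fun n => u.coeff n • (fourier n : C(UnitAddCircle, ℂ)))
        (by simpa only [h] using u.summable_norm_coeff hr)
      rw [(u.hasSum_fourier hr).tsum_eq] at h2
      simp only [h] at h2
      exact h2

@[simp]
theorem toContCLM_apply (hr : 1 / 2 < r) (u : Hs r) : toContCLM hr u = u.toCont := rfl

/-- The mean of an element of `H^r`. -/
def meanCLM (hr : 1 / 2 < r) : Hs r →L[ℝ] ℝ := circleMeanCLM ∘L toContCLM hr

theorem meanCLM_apply (hr : 1 / 2 < r) (u : Hs r) : meanCLM hr u = circleMean u := rfl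

/-- The constant function `1`. -/
def one (r : ℝ) : Hs r :=
  ⟨1, by
    have h : sobolevCoeff r (1 : C(UnitAddCircle, ℝ)) = Pi.single 0 1 := by
      ext n
      have h1 := realFourierCoeff_const 1 n
      change _ * realFourierCoeff (fun _ => 1) n = _
      rw [h1]
      by_cases hn : n = 0
      · subst hn; simp
      · simp [hn]
    change Memℓp (sobolevCoeff r (1 : C(UnitAddCircle, ℝ))) 2
    rw [h]
    exact memℓp_gen (summable_of_hasFiniteSupport ((finite_singleton 0).subset fun n hn => by
      by_contra h0
      exact hn (by simp [Pi.single_eq_of_ne h0])))⟩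

@[simp]
theorem toCont_one : (one r).toCont = 1 := rfl

/-! ### `H^r` is an algebra for `r > 1/2` -/

theorem hasSum_realFourierCoeff_mul (hr : 1 / 2 < r) (u : Hs r) (v : C(UnitAddCircle, ℝ)) (n : ℤ) :
    HasSum (fun k => u.coeff k * realFourierCoeff v (n - k))
      (realFourierCoeff (u.toCont * v : C(UnitAddCircle, ℝ)) n) := by
  have h1 := (fourierCoeffCLM n).hasSum ((u.hasSum_fourier hr).mul_right (complexify v))
  have h2 : complexify u.toCont * complexify v = complexify (u.toCont * v) := by
    ext x; simp
  rw [h2, fourierCoeffCLM_complexify] at h1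
  simpa only [smul_mul_assoc, map_smul, fourierCoeffCLM_fourier_mul, fourierCoeffCLM_complexify,
    smul_eq_mul] using h1

/-- The weights split the coefficients of a product into two convolutions of an `ℓ²` sequence with
an `ℓ¹` sequence. -/
theorem exists_weighted_coeff_mul_le (hr : 1 / 2 < r) (u v : Hs r) :
    ∃ a : lp (fun _ : ℤ => ℝ) 2,
      (∀ n, sobolevWeight r n * ‖realFourierCoeff (u.toCont * v.toCont : C(UnitAddCircle, ℝ)) n‖
        ≤ a n) ∧ ‖a‖ ≤ 4 ^ (r / 2) * (2 * sobolevConst r) * ‖u‖ * ‖v‖ := by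
  have hsum := fun w : Hs r => (w.summable_norm_coeff hr).norm
  obtain ⟨c₁, hc₁, hn₁⟩ := exists_hasSum_convolution (lp.toNorm (toEll2 r u)) (hsum v)
  obtain ⟨c₂, hc₂, hn₂⟩ := exists_hasSum_convolution (lp.toNorm (toEll2 r v)) (hsum u)
  have hw : ∀ (w : Hs r) n, ‖toEll2 r w n‖ = sobolevWeight r n * ‖w.coeff n‖ := fun w n => by
    rw [toEll2_apply, norm_mul, Complex.norm_real, Real.norm_of_nonneg (sobolevWeight_pos r n).le]
  simp only [lp.toNorm_coe, hw] at hc₁ hc₂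
  simp only [norm_norm, lp.norm_toNorm, ← norm_eq] at hn₁ hn₂
  have h4 : (0 : ℝ) ≤ 4 ^ (r / 2) := by positivity
  refine ⟨(4 : ℝ) ^ (r / 2) • (c₁ + c₂), fun n => ?_, ?_⟩
  · have hc₁' := (Equiv.subLeft n).hasSum_iff.2 (hc₁ n)
    have hterm : ∀ k, ‖u.coeff k * v.coeff (n - k)‖ * sobolevWeight r n ≤
        4 ^ (r / 2) * (‖v.coeff (n - k)‖ * (sobolevWeight r k * ‖u.coeff k‖) +
          ‖u.coeff k‖ * (sobolevWeight r (n - k) * ‖v.coeff (n - k)‖)) := fun k => by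
      have h := sobolevWeight_le_add (r := r) (by linarith) k (n - k)
      rw [add_sub_cancel] at h
      rw [norm_mul]
      refine (mul_le_mul_of_nonneg_left h (by positivity)).trans_eq ?_
      ring
    have hc : HasSum (fun k => 4 ^ (r / 2) * (‖v.coeff (n - k)‖ *
        (sobolevWeight r k * ‖u.coeff k‖) +
          ‖u.coeff k‖ * (sobolevWeight r (n - k) * ‖v.coeff (n - k)‖)))
        (4 ^ (r / 2) * (c₁ n + c₂ n)) := by
      refine HasSum.mul_left _ (HasSum.add ?_ (hc₂ n))
      refine hc₁'.congr_fun fun k => ?_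
      simp
    have hS : Summable fun k => ‖u.coeff k * v.coeff (n - k)‖ * sobolevWeight r n :=
      .of_nonneg_of_le (fun k => mul_nonneg (norm_nonneg _) (sobolevWeight_pos r n).le) hterm
        hc.summable
    have hS' : Summable fun k => ‖u.coeff k * v.coeff (n - k)‖ :=
      (summable_mul_right_iff (sobolevWeight_pos r n).ne').1 hS
    rw [mul_comm, ← (hasSum_realFourierCoeff_mul hr u v.toCont n).tsum_eq]
    refine (mul_le_mul_of_nonneg_right (norm_tsum_le_tsum_norm hS')
      (sobolevWeight_pos r n).le).trans ?_
    rw [← tsum_mul_right]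
    refine (hS.tsum_le_tsum hterm hc.summable).trans_eq ?_
    rw [hc.tsum_eq]
    rfl
  · refine (lp.norm_const_smul_le two_ne_zero _ _).trans ?_
    rw [Real.norm_of_nonneg h4]
    have h1 := mul_le_mul_of_nonneg_right (v.tsum_norm_coeff_le hr) (norm_nonneg u)
    have h2 := mul_le_mul_of_nonneg_right (u.tsum_norm_coeff_le hr) (norm_nonneg v)
    have h3 : ‖c₁ + c₂‖ ≤ 2 * sobolevConst r * ‖u‖ * ‖v‖ := by
      refine (norm_add_le _ _).trans ?_
      linarith
    refine (mul_le_mul_of_nonneg_left h3 h4).trans_eq ?_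
    ring

/-- The pointwise product on `H^r`, `r > 1/2`. -/
def mulCLM (hr : 1 / 2 < r) : Hs r →L[ℝ] Hs r →L[ℝ] Hs r :=
  LinearMap.mkContinuous₂
    (LinearMap.mk₂ ℝ
      (fun u v => (⟨u.toCont * v.toCont, by
        obtain ⟨a, ha, -⟩ := exists_weighted_coeff_mul_le hr u v
        refine Memℓp.mono (lp.memℓp a) fun n => ?_
        rw [sobolevCoeff, norm_mul, Complex.norm_real]
        rw [Real.norm_of_nonneg (by positivity)]
        exact ha n⟩ : Hs r))
      (fun _ _ _ => toCont_injective (add_mul _ _ _))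
      (fun _ _ _ => toCont_injective (smul_mul_assoc _ _ _))
      (fun _ _ _ => toCont_injective (mul_add _ _ _))
      (fun _ _ _ => toCont_injective (mul_smul_comm _ _ _)))
    (4 ^ (r / 2) * (2 * sobolevConst r))
    fun u v => by
      obtain ⟨a, ha, hn⟩ := exists_weighted_coeff_mul_le hr u v
      exact (norm_le_of_coeff ha).trans hn

@[simp]
theorem toCont_mulCLM (hr : 1 / 2 < r) (u v : Hs r) :
    (mulCLM hr u v).toCont = u.toCont * v.toCont := rfl

/-! ### Inclusion, derivative and antiderivative -/

/-- The inclusion of `H^s` into `H^(s-1)`. The hypothesis makes both exponents exceed `1/2`. -/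
def incl (hs : 3 / 2 < s) : Hs s →L[ℝ] Hs (s - 1) :=
  multiplier (by linarith) (fun _ => 1) (by simp) 1 fun n => by
    simpa using sobolevWeight_mono (by linarith) n

theorem sobolevWeight_eq_sub_one_mul (s : ℝ) (n : ℤ) :
    sobolevWeight s n = sobolevWeight (s - 1) n * √(1 + (n : ℝ) ^ 2) := by
  rw [← sobolevWeight_one, ← sobolevWeight_add, sub_add_cancel]

theorem norm_derivSymbol (n : ℤ) : ‖derivSymbol n‖ = 2 * Real.pi * |(n : ℝ)| := by
  simp [derivSymbol, abs_of_pos Real.pi_pos]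

theorem derivSymbol_neg (n : ℤ) : derivSymbol (-n) = conj (derivSymbol n) := by
  simp [derivSymbol, Complex.conj_ofReal, Complex.conj_ofNat]

/-- The derivative as an operator from `H^s` to `H^(s-1)`. -/
def derivCLM (hs : 3 / 2 < s) : Hs s →L[ℝ] Hs (s - 1) :=
  multiplier (by linarith) derivSymbol derivSymbol_neg (2 * Real.pi) fun n => by
    have h : |(n : ℝ)| ≤ √(1 + (n : ℝ) ^ 2) := Real.abs_le_sqrt (by linarith)
    rw [norm_derivSymbol, sobolevWeight_eq_sub_one_mul s]
    have h1 := (sobolevWeight_pos (s - 1) n).le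
    calc sobolevWeight (s - 1) n * (2 * Real.pi * |(n : ℝ)|)
        = 2 * Real.pi * sobolevWeight (s - 1) n * |(n : ℝ)| := by ring
      _ ≤ 2 * Real.pi * sobolevWeight (s - 1) n * √(1 + (n : ℝ) ^ 2) :=
          mul_le_mul_of_nonneg_left h (by positivity)
      _ = _ := by ring

/-- The antiderivative of mean zero of `h - ∫ h`, as an operator from `H^(s-1)` to `H^s`. Its symbol
is `1 / (2πin)`, read as `0` at `n = 0`. -/
def antiderivCLM (hs : 3 / 2 < s) : Hs (s - 1) →L[ℝ] Hs s :=
  multiplier (by linarith) (fun n => (derivSymbol n)⁻¹) (fun n => by simp [derivSymbol_neg]) 1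
    fun n => by
      rw [norm_inv, norm_derivSymbol, sobolevWeight_eq_sub_one_mul s, one_mul]
      have h1 := (sobolevWeight_pos (s - 1) n).le
      rcases eq_or_ne n 0 with rfl | hn
      · simpa using h1
      have hn1 : 1 ≤ |(n : ℝ)| := by exact_mod_cast Int.one_le_abs hn
      have h2 : √(1 + (n : ℝ) ^ 2) ≤ 2 * Real.pi * |(n : ℝ)| := by
        refine Real.sqrt_le_iff.2 ⟨by positivity, ?_⟩
        have h3 : 1 ≤ Real.pi := by linarith [Real.pi_gt_three]
        have h4 : 1 + (n : ℝ) ^ 2 ≤ (2 * |(n : ℝ)|) ^ 2 := by nlinarith [sq_abs (n : ℝ)]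
        refine h4.trans (pow_le_pow_left₀ (by positivity) ?_ 2)
        nlinarith
      rw [mul_assoc]
      refine mul_le_of_le_one_right h1 ?_
      rw [← div_eq_mul_inv]
      exact div_le_one_of_le₀ h2 (by positivity)

@[simp]
theorem toCont_incl (hs : 3 / 2 < s) (u : Hs s) : (incl hs u).toCont = u.toCont :=
  eq_of_realFourierCoeff_eq fun n => by
    have h : (incl hs u).coeff n = 1 * u.coeff n := coeff_multiplier ..
    exact h.trans (one_mul _)

theorem coeff_derivCLM (hs : 3 / 2 < s) (u : Hs s) (n : ℤ) :
    (derivCLM hs u).coeff n = derivSymbol n * u.coeff n := coeff_multiplier ..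

theorem coeff_antiderivCLM (hs : 3 / 2 < s) (u : Hs (s - 1)) (n : ℤ) :
    (antiderivCLM hs u).coeff n = (derivSymbol n)⁻¹ * u.coeff n := coeff_multiplier ..

theorem hasDerivAt_coe (hs : 3 / 2 < s) (u : Hs s) (t : ℝ) :
    HasDerivAt (fun t : ℝ => u (t : UnitAddCircle)) (derivCLM hs u t) t := by
  have hs' : 1 / 2 < s - 1 := by linarith
  have hd := hasDerivAt_tsum (𝕜 := ℝ)
    (g := fun n (t : ℝ) => u.coeff n * fourier n (t : UnitAddCircle))
    (g' := fun n t => (derivCLM hs u).coeff n * fourier n (t : UnitAddCircle))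
    ((derivCLM hs u).summable_norm_coeff hs')
    (fun n y => by
      have h := (hasDerivAt_fourier 1 n y).const_mul (u.coeff n)
      rw [coeff_derivCLM, derivSymbol]
      refine h.congr_deriv ?_
      rw [Complex.ofReal_one, div_one]
      ring)
    (fun n y => by rw [norm_mul, fourier_apply, Circle.norm_coe, mul_one])
    (y₀ := 0) ((u.hasSum_fourier_apply (by linarith) _).summable) t
  have h1 : (fun t : ℝ => ∑' n, u.coeff n * fourier n (t : UnitAddCircle))
      = fun t : ℝ => ((u (t : UnitAddCircle) : ℝ) : ℂ) := by
    funext t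
    exact (u.hasSum_fourier_apply (by linarith) _).tsum_eq
  rw [h1, ((derivCLM hs u).hasSum_fourier_apply hs' _).tsum_eq] at hd
  exact Complex.reCLM.hasFDerivAt.comp_hasDerivAt t hd

theorem hasDerivAt_add (hs : 3 / 2 < s) (u : Hs s) (x : UnitAddCircle) :
    HasDerivAt (fun h : ℝ => u (x + (h : UnitAddCircle))) (derivCLM hs u x) 0 := by
  induction x using QuotientAddGroup.induction_on with
  | H t =>
    have h := hasDerivAt_coe hs u (t + 0)
    rw [add_zero] at h
    have h2 := HasDerivAt.comp_const_add (f := fun t : ℝ => u (t : UnitAddCircle)) t 0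
      (by rw [add_zero]; exact h)
    simpa using h2

@[simp]
theorem circleDeriv_eq (hs : 3 / 2 < s) (u : Hs s) (x : UnitAddCircle) :
    circleDeriv u x = derivCLM hs u x := (hasDerivAt_add hs u x).deriv

theorem derivCLM_antiderivCLM (hs : 3 / 2 < s) (u : Hs (s - 1)) (x : UnitAddCircle) :
    derivCLM hs (antiderivCLM hs u) x = u x - circleMean u := by
  have h : (derivCLM hs (antiderivCLM hs u)).toCont + ContinuousMap.const _ (circleMean u)
      = u.toCont := eq_of_realFourierCoeff_eq fun n => by
    rw [realFourierCoeff_add]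
    have h1 := realFourierCoeff_const (circleMean u) n
    have h2 := coeff_derivCLM hs (antiderivCLM hs u) n
    rw [coeff_antiderivCLM] at h2
    refine (congrArg₂ (· + ·) h2 h1).trans ?_
    by_cases hn : n = 0
    · subst hn
      simp [derivSymbol, realFourierCoeff_zero]
    · have : derivSymbol n ≠ 0 := by
        simp [derivSymbol, hn, Real.pi_ne_zero]
      simp [hn, mul_inv_cancel_left₀ this, coeff_def]
  have h1 := congrArg (fun f : C(UnitAddCircle, ℝ) => f x) h
  exact eq_sub_of_add_eq h1

end Hs

/-! ### The force in Lagrangian coordinates -/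

namespace Hs

variable {s : ℝ}

theorem half_lt_sub_one (hs : 3 / 2 < s) : 1 / 2 < s - 1 := by linarith

theorem half_lt_of_three_half_lt (hs : 3 / 2 < s) : 1 / 2 < s := by linarith

/-- The derivative `1 + ∂ₓ g` of the diffeomorphism `x ↦ x + g(x)`. -/
def jacobian (hs : 3 / 2 < s) (g : Hs s) : Hs (s - 1) := one (s - 1) + derivCLM hs g

/-- The displacements near `0` on which the force is given by an explicit smooth formula: those
for which multiplication by `1 + ∂ₓ g` is invertible on `H^(s-1)` and `|∂ₓ g| < 1`. -/
def smallDisplacements (hs : 3 / 2 < s) : Set (Hs s) :=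
  {g | (mulCLM (half_lt_sub_one hs) (jacobian hs g)).IsInvertible ∧ ‖(derivCLM hs g).toCont‖ < 1}

theorem jacobian_pos (hs : 3 / 2 < s) {g : Hs s} (hg : g ∈ smallDisplacements hs)
    (x : UnitAddCircle) : 0 < 1 + derivCLM hs g x := by
  have h1 := (derivCLM hs g).toCont.norm_coe_le_norm x
  have h2 := (abs_le.1 (h1.trans hg.2.le)).1
  have h3 := (abs_lt.1 (h1.trans_lt hg.2)).1
  linarith

/-- The reciprocal of `1 + ∂ₓ g` in `H^(s-1)`, as the solution `q` of `(1 + ∂ₓ g) q = 1`. -/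
def jacobianInv (hs : 3 / 2 < s) (g : Hs s) : Hs (s - 1) :=
  (mulCLM (half_lt_sub_one hs) (jacobian hs g)).inverse (one (s - 1))

theorem jacobian_mul_jacobianInv (hs : 3 / 2 < s) {g : Hs s} (hg : g ∈ smallDisplacements hs)
    (x : UnitAddCircle) : (1 + derivCLM hs g x) * jacobianInv hs g x = 1 := by
  have h : mulCLM (half_lt_sub_one hs) (jacobian hs g) (jacobianInv hs g) = one (s - 1) :=
    hg.1.self_apply_inverse _
  have h1 := congrArg (fun u : Hs (s - 1) => u x) h
  exact h1

theorem contDiff_jacobian (hs : 3 / 2 < s) : ContDiff ℝ 1 (jacobian hs) :=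
  contDiff_const.add (derivCLM hs).contDiff

theorem isOpen_smallDisplacements (hs : 3 / 2 < s) : IsOpen (smallDisplacements hs) := by
  have := completeSpace (half_lt_sub_one hs)
  have h1 : {L : Hs (s - 1) →L[ℝ] Hs (s - 1) | L.IsInvertible} =
      range ((↑) : (Hs (s - 1) ≃L[ℝ] Hs (s - 1)) → Hs (s - 1) →L[ℝ] Hs (s - 1)) := rfl
  refine IsOpen.inter ?_ ?_
  · have h2 := (ContinuousLinearEquiv.isOpen (𝕜 := ℝ) (E := Hs (s - 1)) (F := Hs (s - 1)))
    rw [← h1] at h2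
    exact h2.preimage ((mulCLM (half_lt_sub_one hs)).continuous.comp
      (contDiff_jacobian hs).continuous)
  · exact isOpen_lt (((toContCLM (half_lt_sub_one hs)).continuous.comp
      (derivCLM hs).continuous).norm) continuous_const

theorem zero_mem_smallDisplacements (hs : 3 / 2 < s) : (0 : Hs s) ∈ smallDisplacements hs := by
  refine ⟨?_, by simp⟩
  have : mulCLM (half_lt_sub_one hs) (jacobian hs 0) = .id ℝ _ := by
    ext1 u
    refine toCont_injective ?_
    simp [jacobian]
  rw [this]
  exact ⟨.refl ℝ _, rfl⟩

theorem contDiffAt_jacobianInv (hs : 3 / 2 < s) {g : Hs s} (hg : g ∈ smallDisplacements hs) :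
    ContDiffAt ℝ 1 (jacobianInv hs) g := by
  have := completeSpace (half_lt_sub_one hs)
  have h1 : ContDiffAt ℝ 1 (fun g => mulCLM (half_lt_sub_one hs) (jacobian hs g)) g :=
    ((mulCLM (half_lt_sub_one hs)).contDiff.comp (contDiff_jacobian hs)).contDiffAt
  have h2 := (ContinuousLinearMap.IsInvertible.contDiffAt_map_inverse (n := 1) hg.1).comp g h1
  exact h2.clm_apply contDiffAt_const

/-- The pull-back `(1 + ∂ₓ g) (2 μ(u) u + (1/2) (∂ₓ u)²) ∘ η` of the Eulerian force, where
`η(x) = x + g(x)` and `u = w ∘ η⁻¹`. -/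
def forceDensity (hs : 3 / 2 < s) (g w : Hs s) : Hs (s - 1) :=
  (2 * meanCLM (half_lt_sub_one hs) (mulCLM (half_lt_sub_one hs) (incl hs w) (jacobian hs g))) •
      mulCLM (half_lt_sub_one hs) (incl hs w) (jacobian hs g) +
    (1 / 2 : ℝ) • mulCLM (half_lt_sub_one hs)
      (mulCLM (half_lt_sub_one hs) (derivCLM hs w) (derivCLM hs w)) (jacobianInv hs g)

/-- The antiderivative of mean zero of `(1 + ∂ₓ g) (h ∘ η - ∫ h)`, where `h` is the Eulerian force: the
integral of the force density is `∫ h`, because `∫ (1 + ∂ₓ g) = 1`. -/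
def forcePrimitive (hs : 3 / 2 < s) (g w : Hs s) : Hs s :=
  antiderivCLM hs (forceDensity hs g w -
    meanCLM (half_lt_sub_one hs) (forceDensity hs g w) • jacobian hs g)

/-- The right-hand side `f(η, w)` of the equation, as a function of the displacement `g` of `η`. The
constant is chosen so that `f ∘ η⁻¹` has mean zero, that is, `∫ f (1 + ∂ₓ g) = 0`. -/
def force (hs : 3 / 2 < s) (g w : Hs s) : Hs s :=
  forcePrimitive hs g w -
    meanCLM (half_lt_sub_one hs)
      (mulCLM (half_lt_sub_one hs) (incl hs (forcePrimitive hs g w)) (jacobian hs g)) • one s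

theorem contDiffAt_force (hs : 3 / 2 < s) {p : Hs s × Hs s} (hp : p.1 ∈ smallDisplacements hs) :
    ContDiffAt ℝ 1 (fun p : Hs s × Hs s => force hs p.1 p.2) p := by
  set M := mulCLM (half_lt_sub_one hs)
  set μ := meanCLM (half_lt_sub_one hs)
  have hJ : ContDiffAt ℝ 1 (fun p : Hs s × Hs s => jacobian hs p.1) p :=
    ((contDiff_jacobian hs).comp contDiff_fst).contDiffAt
  have hq : ContDiffAt ℝ 1 (fun p : Hs s × Hs s => jacobianInv hs p.1) p :=
    (contDiffAt_jacobianInv hs hp).comp p contDiffAt_fst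
  have hM : ∀ {a b : Hs s × Hs s → Hs (s - 1)}, ContDiffAt ℝ 1 a p → ContDiffAt ℝ 1 b p →
      ContDiffAt ℝ 1 (fun p => M (a p) (b p)) p := fun ha hb =>
    (M.contDiff.contDiffAt.comp p ha).clm_apply hb
  have hw : ContDiffAt ℝ 1 (fun p : Hs s × Hs s => incl hs p.2) p :=
    ((incl hs).contDiff.comp contDiff_snd).contDiffAt
  have hw' : ContDiffAt ℝ 1 (fun p : Hs s × Hs s => derivCLM hs p.2) p :=
    ((derivCLM hs).contDiff.comp contDiff_snd).contDiffAt
  have hS : ContDiffAt ℝ 1 (fun p : Hs s × Hs s => forceDensity hs p.1 p.2) p := by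
    have h1 := hM hw hJ
    have h2 := μ.contDiff.contDiffAt.comp p h1
    exact ((contDiffAt_const.mul h2).smul h1).add ((hM (hM hw' hw') hq).const_smul _)
  have hF : ContDiffAt ℝ 1 (fun p : Hs s × Hs s => forcePrimitive hs p.1 p.2) p := by
    have h1 := μ.contDiff.contDiffAt.comp p hS
    exact (antiderivCLM hs).contDiff.contDiffAt.comp p (hS.sub (h1.smul hJ))
  have h1 := (incl hs).contDiff.contDiffAt.comp p hF
  exact hF.sub ((μ.contDiff.contDiffAt.comp p (hM h1 hJ)).smul contDiffAt_const)

theorem meanCLM_one {r : ℝ} (hr : 1 / 2 < r) : meanCLM hr (one r) = 1 := circleMean_const 1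

theorem meanCLM_derivCLM (hs : 3 / 2 < s) (g : Hs s) :
    meanCLM (half_lt_sub_one hs) (derivCLM hs g) = 0 := by
  have h := coeff_derivCLM hs g 0
  rw [coeff_def, realFourierCoeff_zero, derivSymbol] at h
  simpa [meanCLM_apply] using h

theorem meanCLM_jacobian (hs : 3 / 2 < s) (g : Hs s) :
    meanCLM (half_lt_sub_one hs) (jacobian hs g) = 1 := by
  rw [jacobian, map_add, meanCLM_derivCLM, meanCLM_one, add_zero]

theorem derivCLM_one (hs : 3 / 2 < s) : derivCLM hs (one s) = 0 := by
  refine toCont_injective (ContinuousMap.ext fun x => ?_)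
  have h := (hasDerivAt_add hs (one s) x).unique (by simpa using hasDerivAt_const (0 : ℝ) (1 : ℝ))
  simpa using h

theorem derivCLM_force (hs : 3 / 2 < s) (g w : Hs s) (x : UnitAddCircle) :
    derivCLM hs (force hs g w) x = forceDensity hs g w x -
      circleMean (forceDensity hs g w) * (1 + derivCLM hs g x) := by
  rw [force, map_sub, map_smul, derivCLM_one, smul_zero, sub_zero, forcePrimitive,
    derivCLM_antiderivCLM, ← meanCLM_apply (half_lt_sub_one hs), map_sub, map_smul,
    meanCLM_jacobian, smul_eq_mul, mul_one, sub_self, sub_zero]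
  rfl

theorem circleMean_force_mul_jacobian (hs : 3 / 2 < s) (g w : Hs s) :
    circleMean (fun x => force hs g w x * (1 + derivCLM hs g x)) = 0 := by
  have h : meanCLM (half_lt_sub_one hs)
      (mulCLM (half_lt_sub_one hs) (incl hs (force hs g w)) (jacobian hs g)) = 0 := by
    have h1 : mulCLM (half_lt_sub_one hs) (incl hs (one s)) (jacobian hs g) = jacobian hs g :=
      toCont_injective (by simp)
    rw [force, map_sub, map_sub, map_smul, map_smul, sub_apply,
      smul_apply, map_sub, map_smul, h1, meanCLM_jacobian, smul_eq_mul,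
      mul_one, sub_self]
  rw [meanCLM_apply] at h
  simp only [toCont_mulCLM, toCont_incl] at h
  exact h

end Hs

/-! ### Functions of class `C¹` on the circle -/

theorem hasDerivAt_coe_of_hasDerivAt_add {E : Type*} [NormedAddCommGroup E] [NormedSpace ℝ E]
    {q : UnitAddCircle → E} {q' : E} {t : ℝ}
    (h : HasDerivAt (fun h : ℝ => q ((t : UnitAddCircle) + (h : UnitAddCircle))) q' 0) :
    HasDerivAt (fun t : ℝ => q (t : UnitAddCircle)) q' t := by
  have h1 := HasDerivAt.comp_sub_const
    (f := fun h : ℝ => q ((t : UnitAddCircle) + (h : UnitAddCircle))) t t (by rwa [sub_self])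
  refine h1.congr_of_eventuallyEq (.of_forall fun y => ?_)
  simp only [← AddCircle.coe_add, add_sub_cancel]

theorem hasDerivAt_add_of_hasDerivAt_coe {E : Type*} [NormedAddCommGroup E] [NormedSpace ℝ E]
    {q : UnitAddCircle → E} {q' : E} {t : ℝ}
    (h : HasDerivAt (fun t : ℝ => q (t : UnitAddCircle)) q' t) :
    HasDerivAt (fun h : ℝ => q ((t : UnitAddCircle) + (h : UnitAddCircle))) q' 0 := by
  have h2 := HasDerivAt.comp_const_add (f := fun t : ℝ => q (t : UnitAddCircle)) t 0
    (by rwa [add_zero])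
  simpa using h2

/-- The Fourier coefficients of a derivative. -/
theorem realFourierCoeff_of_hasDerivAt {q q' : UnitAddCircle → ℝ} (hq' : Continuous q')
    (h : ∀ x, HasDerivAt (fun h : ℝ => q (x + (h : UnitAddCircle))) (q' x) 0) (n : ℤ) :
    realFourierCoeff q' n = derivSymbol n * realFourierCoeff q n := by
  have hq : ∀ t : ℝ, HasDerivAt (fun t : ℝ => (q (t : UnitAddCircle) : ℂ))
      (q' (t : UnitAddCircle) : ℂ) t := fun t =>
    (hasDerivAt_coe_of_hasDerivAt_add (h t)).ofReal_comp
  have hqc : Continuous fun t : ℝ => (q (t : UnitAddCircle) : ℂ) :=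
    continuous_iff_continuousAt.2 fun t => (hq t).continuousAt
  have hd : ∀ t : ℝ, HasDerivAt
      (fun t : ℝ => fourier (-n) (t : UnitAddCircle) * (q (t : UnitAddCircle) : ℂ))
      (-derivSymbol n * (fourier (-n) (t : UnitAddCircle) * (q (t : UnitAddCircle) : ℂ)) +
        fourier (-n) (t : UnitAddCircle) * (q' (t : UnitAddCircle) : ℂ)) t := fun t => by
    refine ((hasDerivAt_fourier_neg 1 n t).mul (hq t)).congr_deriv ?_
    rw [derivSymbol, Complex.ofReal_one, div_one]
    ring
  have hf : Continuous fun t : ℝ => (fourier (-n) (t : UnitAddCircle) : ℂ) :=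
    (map_continuous (fourier (-n))).comp (AddCircle.continuous_mk' 1)
  have hq'c : Continuous fun t : ℝ => (q' (t : UnitAddCircle) : ℂ) :=
    Complex.continuous_ofReal.comp (hq'.comp (AddCircle.continuous_mk' 1))
  -- the product of `q` and a character is periodic, so its derivative integrates to zero
  have hi := intervalIntegral.integral_eq_sub_of_hasDerivAt (a := 0) (b := 0 + 1)
    (fun t _ => hd t) (Continuous.intervalIntegrable (by fun_prop) _ _)
  rw [intervalIntegral.integral_add (Continuous.intervalIntegrable (by fun_prop) _ _)
    (Continuous.intervalIntegrable (by fun_prop) _ _), intervalIntegral.integral_const_mul,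
    AddCircle.coe_add_period, sub_self] at hi
  rw [realFourierCoeff, realFourierCoeff, fourierCoeff_eq_intervalIntegral _ n 0,
    fourierCoeff_eq_intervalIntegral _ n 0]
  simp only [smul_eq_mul, div_one, one_smul]
  linear_combination hi

theorem memℓp_realFourierCoeff (u : C(UnitAddCircle, ℝ)) : Memℓp (realFourierCoeff u) 2 := by
  have h := hasSum_sq_fourierCoeff (ContinuousMap.toLp (E := ℂ) 2 AddCircle.haarAddCircle ℂ
    (complexify u))
  simp_rw [fourierCoeff_toLp] at h
  refine memℓp_gen ?_
  simpa using! h.summable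

/-- A function of class `C¹` lies in `H¹`. -/
theorem exists_toCont_eq_of_hasDerivAt {q q' : UnitAddCircle → ℝ} (hqc : Continuous q)
    (hq' : Continuous q')
    (h : ∀ x, HasDerivAt (fun h : ℝ => q (x + (h : UnitAddCircle))) (q' x) 0) :
    ∃ u : Hs 1, u.toCont = ⟨q, hqc⟩ := by
  refine ⟨⟨⟨q, hqc⟩, ?_⟩, rfl⟩
  change Memℓp (fun n => (sobolevWeight 1 n : ℂ) * realFourierCoeff q n) 2
  refine Memℓp.mono ((memℓp_realFourierCoeff ⟨q, hqc⟩).norm.add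
    (memℓp_realFourierCoeff ⟨q', hq'⟩).norm) fun n => ?_
  have h1 : ‖realFourierCoeff q' n‖ = 2 * Real.pi * |(n : ℝ)| * ‖realFourierCoeff q n‖ := by
    rw [realFourierCoeff_of_hasDerivAt hq' h, norm_mul, Hs.norm_derivSymbol]
  change _ ≤ ‖realFourierCoeff q n‖ + ‖realFourierCoeff q' n‖
  rw [h1, norm_mul, Complex.norm_real, Real.norm_of_nonneg (sobolevWeight_pos 1 n).le,
    sobolevWeight_one]
  have h2 : √(1 + (n : ℝ) ^ 2) ≤ 1 + 2 * Real.pi * |(n : ℝ)| := by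
    have h3 := Real.pi_gt_three
    have h4 : |(n : ℝ)| ≤ 2 * Real.pi * |(n : ℝ)| := by
      nlinarith [abs_nonneg (n : ℝ)]
    refine Real.sqrt_le_iff.2 ⟨by positivity, ?_⟩
    nlinarith [sq_abs (n : ℝ), abs_nonneg (n : ℝ)]
  nlinarith [norm_nonneg (realFourierCoeff q n)]

theorem unitAddCircle_coe_eq_coe_iff {a b : ℝ} :
    (a : UnitAddCircle) = b ↔ ∃ k : ℤ, a = b + k := by
  rw [← sub_eq_zero, ← AddCircle.coe_sub, AddCircle.coe_eq_zero_iff]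
  simp only [zsmul_eq_mul, mul_one]
  exact exists_congr fun k => ⟨fun h => by linarith, fun h => by linarith⟩

/-! ### Diffeomorphisms of the circle and their lifts -/

namespace Hs

variable {s : ℝ}

/-- The lift `t ↦ t + g(t)` to the real line of the circle map with displacement `g`. -/
def lift (g : Hs s) (t : ℝ) : ℝ := t + g (t : UnitAddCircle)

theorem lift_add_intCast (g : Hs s) (t : ℝ) (k : ℤ) : g.lift (t + k) = g.lift t + k := by
  have h : ((t + k : ℝ) : UnitAddCircle) = (t : UnitAddCircle) :=
    unitAddCircle_coe_eq_coe_iff.2 ⟨k, rfl⟩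
  rw [lift, lift, h]
  ring

theorem coe_lift (g : Hs s) (t : ℝ) :
    ((g.lift t : ℝ) : UnitAddCircle) =
      (t : UnitAddCircle) + ((g (t : UnitAddCircle) : ℝ) : UnitAddCircle) :=
  AddCircle.coe_add 1 t _

theorem hasDerivAt_lift (hs : 3 / 2 < s) (g : Hs s) (t : ℝ) :
    HasDerivAt g.lift (1 + derivCLM hs g t) t :=
  (hasDerivAt_id t).add (hasDerivAt_coe hs g t)

theorem continuous_lift (g : Hs s) : Continuous g.lift :=
  continuous_id.add ((map_continuous g.toCont).comp (AddCircle.continuous_mk' 1))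

variable {hs : 3 / 2 < s} {g : Hs s}

theorem strictMono_lift (hpos : ∀ x, 0 < 1 + derivCLM hs g x) : StrictMono g.lift :=
  strictMono_of_deriv_pos fun t => by
    rw [(hasDerivAt_lift hs g t).deriv]
    exact hpos _

theorem surjective_lift (g : Hs s) : Function.Surjective g.lift := by
  have hb : ∀ x, |g x| ≤ ‖g.toCont‖ := fun x => g.toCont.norm_coe_le_norm x
  refine g.continuous_lift.surjective ?_ ?_
  · refine tendsto_atTop_mono (fun t => ?_)
      (tendsto_atTop_add_const_right _ (-‖g.toCont‖) tendsto_id)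
    have := (abs_le.1 (hb t)).1
    simp only [id, lift]
    linarith
  · refine tendsto_atBot_mono (fun t => ?_) (tendsto_atBot_add_const_right _ ‖g.toCont‖ tendsto_id)
    have := (abs_le.1 (hb t)).2
    simp only [id, lift]
    linarith

/-- The derivative of `q` at `η(x)` when `q ∘ η` is a function `w` in `H^s`. -/
theorem hasDerivAt_of_comp_eq (hpos : ∀ x, 0 < 1 + derivCLM hs g x)
    {η : UnitAddCircle → UnitAddCircle} (hη : IsDisplacement η g) {q : UnitAddCircle → ℝ} {w : Hs s}
    (hq : ∀ x, q (η x) = w x) (x : UnitAddCircle) :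
    HasDerivAt (fun h : ℝ => q (η x + (h : UnitAddCircle)))
      (derivCLM hs w x / (1 + derivCLM hs g x)) 0 := by
  induction x using QuotientAddGroup.induction_on with
  | H t =>
    -- the lift of `q` is the lift of `w` composed with the inverse `e.symm` of the lift of `η`
    let e : ℝ ≃ₜ ℝ := ((strictMono_lift hpos).orderIsoOfSurjective _ g.surjective_lift).toHomeomorph
    have he : ∀ t, e t = g.lift t := fun _ => rfl
    have hη' : ∀ t : ℝ, η (t : UnitAddCircle) = ((g.lift t : ℝ) : UnitAddCircle) := fun t => by
      rw [coe_lift]; exact hη _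
    have h1 : HasDerivAt e.symm (1 + derivCLM hs g t)⁻¹ (g.lift t) := by
      refine HasDerivAt.of_local_left_inverse (f := g.lift) e.symm.continuous.continuousAt ?_
        (hpos _).ne' (.of_forall fun y => e.apply_symm_apply y)
      rw [← he, e.symm_apply_apply]
      exact hasDerivAt_lift hs g t
    have h2 : HasDerivAt (fun t : ℝ => w (t : UnitAddCircle)) (derivCLM hs w t)
        (e.symm (g.lift t)) := by
      rw [← he, e.symm_apply_apply]
      exact hasDerivAt_coe hs w t
    have h3 := h2.comp _ h1
    change HasDerivAt (fun h : ℝ => q (η (t : UnitAddCircle) + (h : UnitAddCircle))) _ 0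
    rw [hη']
    refine hasDerivAt_add_of_hasDerivAt_coe (h3.congr_of_eventuallyEq (.of_forall fun y => ?_))
    simp only [Function.comp_apply]
    refine Eq.trans ?_ (hq _)
    rw [hη', ← he, e.apply_symm_apply]

/-- Change of variables `y = η(x)` in the mean. Only the degree of `η` matters, not its
injectivity. -/
theorem circleMean_comp (hs : 3 / 2 < s) {η : UnitAddCircle → UnitAddCircle}
    (hη : IsDisplacement η g) {q : UnitAddCircle → ℝ} (hq : Continuous q) :
    circleMean (fun x => q (η x) * (1 + derivCLM hs g x)) = circleMean q := by
  have h1 := intervalIntegral.integral_comp_mul_deriv (a := 0) (b := 1)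
    (g := fun t : ℝ => q (t : UnitAddCircle)) (fun t _ => hasDerivAt_lift hs g t)
    (Continuous.continuousOn (continuous_const.add
      ((map_continuous (derivCLM hs g).toCont).comp (AddCircle.continuous_mk' 1))))
    (hq.comp (AddCircle.continuous_mk' 1))
  have h2 : g.lift 1 = g.lift 0 + 1 := by
    have := g.lift_add_intCast 0 1
    simpa using this
  rw [h2, UnitAddCircle.intervalIntegral_preimage] at h1
  have h3 := UnitAddCircle.intervalIntegral_preimage 0 fun x => q (η x) * (1 + derivCLM hs g x)
  rw [zero_add] at h3
  rw [circleMean, circleMean, ← h3, ← h1]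
  refine intervalIntegral.integral_congr fun t _ => ?_
  simp only [Function.comp_apply, coe_lift]
  rw [← hη]

theorem continuous_displace (g : Hs s) :
    Continuous fun x : UnitAddCircle => x + ((g x : ℝ) : UnitAddCircle) :=
  continuous_id.add ((AddCircle.continuous_mk' 1).comp (map_continuous g.toCont))

theorem bijective_displace (hpos : ∀ x, 0 < 1 + derivCLM hs g x) :
    Function.Bijective fun x : UnitAddCircle => x + ((g x : ℝ) : UnitAddCircle) := by
  constructor
  · intro x y hxy
    induction x using QuotientAddGroup.induction_on with
    | H a =>
    induction y using QuotientAddGroup.induction_on with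
    | H b =>
    have h1 : ((g.lift a : ℝ) : UnitAddCircle) = ((g.lift b : ℝ) : UnitAddCircle) := by
      rw [coe_lift, coe_lift]; exact hxy
    obtain ⟨k, hk⟩ := unitAddCircle_coe_eq_coe_iff.1 h1
    rw [← lift_add_intCast] at hk
    exact unitAddCircle_coe_eq_coe_iff.2 ⟨k, (strictMono_lift hpos).injective hk⟩
  · intro y
    induction y using QuotientAddGroup.induction_on with
    | H b =>
    obtain ⟨a, ha⟩ := g.surjective_lift b
    exact ⟨(a : UnitAddCircle), by rw [← ha]; exact (g.coe_lift a).symm⟩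

end Hs

/-- The diffeomorphism `x ↦ x + g(x)`. -/
def Ds.ofDisplacement {s : ℝ} (hs : 3 / 2 < s) (g : Hs s)
    (hpos : ∀ x, 0 < 1 + Hs.derivCLM hs g x) : Ds s where
  toHomeomorph := Continuous.homeoOfEquivCompactToT2
    (f := Equiv.ofBijective _ (Hs.bijective_displace hpos)) g.continuous_displace
  exists_displacement := ⟨g, fun _ => rfl, fun x => by rw [Hs.circleDeriv_eq hs]; exact hpos x⟩

theorem Ds.isDisplacement_ofDisplacement {s : ℝ} (hs : 3 / 2 < s) (g : Hs s)
    (hpos : ∀ x, 0 < 1 + Hs.derivCLM hs g x) :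
    IsDisplacement (Ds.ofDisplacement hs g hpos) g := fun _ => rfl

/-! ### The Eulerian and the Lagrangian form of the force agree -/

/-- If `P` has mean zero and `∂ₓ P = -(h - ∫ h)`, then `A⁻¹ ∂ₓ h = P`. For `h` merely continuous the
equation `A P = ∂ₓ h` is read in the Fourier coefficients; the series of `P` converges to `P` because
`P` is of class `C¹`. -/
theorem inertiaInvDeriv_eq {h P : UnitAddCircle → ℝ} (hh : Continuous h) (hP : Continuous P)
    (hPm : circleMean P = 0)
    (hd : ∀ x, HasDerivAt (fun t : ℝ => P (x + (t : UnitAddCircle))) (-(h x - circleMean h)) 0)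
    (y : UnitAddCircle) : inertiaInvDeriv h y = P y := by
  have hc : Continuous fun x => -(h x - circleMean h) := (hh.sub continuous_const).neg
  obtain ⟨u, hu⟩ := exists_toCont_eq_of_hasDerivAt hP hc hd
  have hsum := u.hasSum_fourier_apply (by norm_num) y
  have hcoeff : ∀ n, u.coeff n = (inertiaSymbol n)⁻¹ * (derivSymbol n * realFourierCoeff h n) := by
    intro n
    have hPn : u.coeff n = realFourierCoeff P n := by rw [Hs.coeff_def, hu]; rfl
    rw [hPn]
    by_cases hn : n = 0
    · subst hn
      simp [realFourierCoeff_zero, hPm, derivSymbol]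
    · have h1 := realFourierCoeff_of_hasDerivAt hc hd n
      have h2 : (⟨_, hc⟩ : C(UnitAddCircle, ℝ)) =
          (-1 : ℝ) • ⟨h, hh⟩ + ContinuousMap.const _ (circleMean h) := by
        ext x
        simp
        ring
      have h3 := congrArg (fun f : C(UnitAddCircle, ℝ) => realFourierCoeff f n) h2
      have h4 : realFourierCoeff (ContinuousMap.const UnitAddCircle (circleMean h)) n = 0 := by
        have := realFourierCoeff_const (circleMean h) n
        rw [if_neg hn] at this
        exact this
      simp only [realFourierCoeff_add, realFourierCoeff_smul, h4, add_zero] at h3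
      have h5 : -realFourierCoeff h n = derivSymbol n * realFourierCoeff P n := by
        rw [← h1]
        refine Eq.trans ?_ h3.symm
        simp
      have h6 : derivSymbol n ≠ 0 := by simp [derivSymbol, hn, Real.pi_ne_zero]
      have h7 : inertiaSymbol n = -derivSymbol n ^ 2 := by
        rw [inertiaSymbol, if_neg hn, derivSymbol]; ring
      have h8 : realFourierCoeff h n = -(derivSymbol n * realFourierCoeff P n) := by
        rw [← h5, neg_neg]
      rw [h7, h8]
      field_simp
  simp only [hcoeff] at hsum
  rw [inertiaInvDeriv, hsum.tsum_eq, hu]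
  rfl

namespace Hs

variable {s : ℝ} {hs : 3 / 2 < s}

theorem forceDensity_apply (hs : 3 / 2 < s) (g w : Hs s) (x : UnitAddCircle) :
    forceDensity hs g w x =
      2 * circleMean (fun x => w x * (1 + derivCLM hs g x)) * (w x * (1 + derivCLM hs g x)) +
        1 / 2 * (derivCLM hs w x * derivCLM hs w x * jacobianInv hs g x) := by
  have h : meanCLM (half_lt_sub_one hs)
      (mulCLM (half_lt_sub_one hs) (incl hs w) (jacobian hs g)) =
      circleMean (fun x => w x * (1 + derivCLM hs g x)) := by
    rw [meanCLM_apply, toCont_mulCLM, toCont_incl]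
    rfl
  rw [forceDensity, h, toCont_add, toCont_smul, toCont_smul, toCont_mulCLM, toCont_mulCLM,
    toCont_mulCLM, toCont_incl]
  rfl

/-- For a small displacement `g` of `η`, the force `f(η, w)` is `force hs g w`. -/
theorem lagrangianForce_eq {g : Hs s} (hg : g ∈ smallDisplacements hs) {η : Ds s}
    (hη : IsDisplacement η g) (w : Hs s) (x : UnitAddCircle) :
    lagrangianForce η w x = (force hs g w x : ℂ) := by
  have hpos := jacobian_pos hs hg
  set e := η.toHomeomorph with he
  have hcomp : ∀ {q : UnitAddCircle → ℝ}, Continuous (fun x => q (e x)) → Continuous q := by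
    intro q hq
    have := hq.comp e.symm.continuous
    simpa [Function.comp_def] using this
  set u := eulerianVelocity η w with hu
  have hue : ∀ x, u (e x) = w x := fun x => by
    simp only [hu, eulerianVelocity, ← he, e.symm_apply_apply]
  have hw : Continuous fun x => w x := map_continuous w.toCont
  have hDg : Continuous fun x => derivCLM hs g x := map_continuous (derivCLM hs g).toCont
  have hDw : Continuous fun x => derivCLM hs w x := map_continuous (derivCLM hs w).toCont
  have hF : Continuous fun x => force hs g w x := map_continuous (force hs g w).toCont
  have huc : Continuous u := hcomp (by simpa only [hue] using hw)
  have hmean : circleMean u = circleMean (fun x => w x * (1 + derivCLM hs g x)) := by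
    rw [← circleMean_comp hs hη huc]
    simp only [hue]
  have hderiv : ∀ x, circleDeriv u (e x) = derivCLM hs w x / (1 + derivCLM hs g x) := fun x =>
    (hasDerivAt_of_comp_eq hpos hη hue x).deriv
  set h := eulerianForce u with hh
  have hhe : ∀ x, h (e x) = 2 * circleMean u * w x +
      1 / 2 * (derivCLM hs w x / (1 + derivCLM hs g x)) ^ 2 := fun x => by
    rw [hh, eulerianForce, hue, hderiv]
  have hhc : Continuous h := hcomp (by
    simp only [hhe]
    exact (continuous_const.mul hw).add (continuous_const.mul
      ((hDw.div (continuous_const.add hDg) fun x => (hpos x).ne').pow 2)))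
  have hinv : ∀ x, jacobianInv hs g x = (1 + derivCLM hs g x)⁻¹ := fun x =>
    eq_inv_of_mul_eq_one_right (jacobian_mul_jacobianInv hs hg x)
  have hS : ∀ x, forceDensity hs g w x = h (e x) * (1 + derivCLM hs g x) := fun x => by
    have := (hpos x).ne'
    rw [forceDensity_apply, hhe, hinv, ← hmean]
    field_simp
  have hSm : circleMean (forceDensity hs g w) = circleMean h := by
    rw [← circleMean_comp hs hη hhc]
    exact congrArg circleMean (funext hS)
  -- `P` is a candidate for `A⁻¹ ∂ₓ h`; its derivative is computed from that of `P ∘ η = -f`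
  let P : UnitAddCircle → ℝ := fun y => -force hs g w (e.symm y)
  have hPe : ∀ x, P (e x) = (-force hs g w) x := fun x => by
    simp only [P, e.symm_apply_apply]
    rfl
  have hPc : Continuous P := (hF.comp e.symm.continuous).neg
  have hPm : circleMean P = 0 := by
    rw [← circleMean_comp hs hη hPc]
    have h1 := circleMean_force_mul_jacobian hs g w
    have h2 : (fun x => P (e x) * (1 + derivCLM hs g x)) =
        fun x => -(force hs g w x * (1 + derivCLM hs g x)) := funext fun x =>
      (congrArg (· * (1 + derivCLM hs g x)) (hPe x)).trans (neg_mul _ _)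
    rw [h2, circleMean, integral_neg, neg_eq_zero]
    exact h1
  have hPd : ∀ y, HasDerivAt (fun t : ℝ => P (y + (t : UnitAddCircle)))
      (-(h y - circleMean h)) 0 := by
    intro y
    obtain ⟨x, rfl⟩ := e.surjective y
    refine (hasDerivAt_of_comp_eq hpos hη hPe x).congr_deriv ?_
    have h1 : derivCLM hs (-force hs g w) x = -derivCLM hs (force hs g w) x := by
      rw [map_neg]
      rfl
    rw [h1, derivCLM_force, hS, hSm]
    have := (hpos x).ne'
    field_simp
  rw [lagrangianForce, ← hu, ← hh, inertiaInvDeriv_eq hhc hPc hPm hPd]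
  change -((P (e x) : ℝ) : ℂ) = _
  rw [← Complex.ofReal_neg, hPe]
  exact congrArg _ (neg_neg _)

end Hs

/-! ### Curves of diffeomorphisms and their displacements -/

section Displacement

variable {s : ℝ}

theorem Hs.one_ne_zero : Hs.one s ≠ 0 := fun h => by
  have h1 := congrArg (fun u : Hs s => u.toCont 0) h
  simp at h1

theorem IsDisplacement.add_intCast {φ : UnitAddCircle → UnitAddCircle} {g : Hs s}
    (hg : IsDisplacement φ g) (k : ℤ) : IsDisplacement φ (g + (k : ℝ) • Hs.one s) := fun x => by
  rw [hg x]
  congr 1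
  exact unitAddCircle_coe_eq_coe_iff.2 ⟨-k, by simp⟩

theorem IsDisplacement.exists_eq_add_intCast {φ : UnitAddCircle → UnitAddCircle} {g g' : Hs s}
    (hg : IsDisplacement φ g) (hg' : IsDisplacement φ g') :
    ∃ k : ℤ, g = g' + (k : ℝ) • Hs.one s := by
  have h : ∀ x, ∃ k : ℤ, g x = g' x + k := fun x =>
    unitAddCircle_coe_eq_coe_iff.1 (add_left_cancel ((hg x).symm.trans (hg' x)))
  choose k hk using h
  have hc : Continuous k := by
    rw [Int.isClosedEmbedding_coe_real.isInducing.continuous_iff]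
    have : ((↑) ∘ k : UnitAddCircle → ℝ) = fun x => g x - g' x := funext fun x => by
      rw [hk x]; simp
    rw [this]
    exact (map_continuous g.toCont).sub (map_continuous g'.toCont)
  refine ⟨k 0, Hs.toCont_injective (ContinuousMap.ext fun x => ?_)⟩
  have h1 : k x = k 0 := PreconnectedSpace.constant inferInstance hc
  refine (hk x).trans ?_
  rw [h1]
  simp

theorem IsDisplacement.ds_eq {ξ η : Ds s} {g : Hs s} (hξ : IsDisplacement ξ g)
    (hη : IsDisplacement η g) : ξ = η :=
  Ds.ext (Homeomorph.ext fun x => (hξ x).trans (hη x).symm)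

/-- The velocity of a curve in `D^s` is the derivative of every continuous local choice of
displacements: two choices differ by integers, which are locally constant in time. -/
theorem Ds.HasVelocityAt.hasDerivAt {η : ℝ → Ds s} {w : Hs s} {t : ℝ} (h : Ds.HasVelocityAt η w t)
    {g : ℝ → Hs s} (hg : ContinuousAt g t) (hη : ∀ᶠ r in 𝓝 t, IsDisplacement (η r) (g r)) :
    HasDerivAt g w t := by
  obtain ⟨γ, hγ, hηγ⟩ := h
  have hn : 0 < ‖Hs.one s‖ := norm_pos_iff.2 Hs.one_ne_zero
  obtain ⟨k₀, hk₀⟩ := hη.self_of_nhds.exists_eq_add_intCast hηγ.self_of_nhds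
  have hcont : ContinuousAt (fun r => g r - γ r) t := hg.sub hγ.continuousAt
  refine (hγ.add_const ((k₀ : ℝ) • Hs.one s)).congr_of_eventuallyEq ?_
  filter_upwards [hη, hηγ, hcont (Metric.ball_mem_nhds _ hn)] with r h1 h2 h3
  obtain ⟨k, hk⟩ := h1.exists_eq_add_intCast h2
  rw [mem_preimage, Metric.mem_ball, dist_eq_norm, hk, hk₀, add_sub_cancel_left,
    add_sub_cancel_left, ← sub_smul, norm_smul] at h3
  have h4 : ‖((k : ℝ) - k₀)‖ < 1 := by
    by_contra hcon
    nlinarith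
  have h5 : k = k₀ := by
    rw [Real.norm_eq_abs, ← Int.cast_sub, ← Int.cast_abs] at h4
    have h6 : |k - k₀| < 1 := by exact_mod_cast h4
    exact sub_eq_zero.1 (Int.abs_lt_one_iff.1 h6)
  rw [hk, h5]

theorem Ds.IsC1At.continuousAt_apply (hs : 3 / 2 < s) {E : Type*} [NormedAddCommGroup E]
    [NormedSpace ℝ E] {F : E → Ds s} {p : E} (h : Ds.IsC1At F p) (x : UnitAddCircle) :
    ContinuousAt (fun q => F q x) p := by
  obtain ⟨g, hg, hF⟩ := h
  have h1 : ContinuousAt (fun q => x + ((g q x : ℝ) : UnitAddCircle)) p := by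
    refine continuousAt_const.add ?_
    refine ContinuousAt.comp (g := fun a : ℝ => (a : UnitAddCircle))
      (AddCircle.continuous_mk' 1).continuousAt ?_
    exact ((ContinuousMap.evalCLM ℝ x).continuous.comp
      (Hs.toContCLM (Hs.half_lt_of_three_half_lt hs)).continuous).continuousAt.comp hg.continuousAt
  exact h1.congr (hF.mono fun q hq => (hq x).symm)

end Displacement

/-! ### Uniqueness of solutions -/

section Uniqueness

variable {s : ℝ}

theorem IsLagrangianSolution.mono {T T' : ℝ} (h : T' ≤ T) {u : Hs s} {η : ℝ → Ds s} {v : ℝ → Hs s}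
    (hη : IsLagrangianSolution T u η v) : IsLagrangianSolution T' u η v := by
  have hI : Ioo (-T') T' ⊆ Ioo (-T) T := Ioo_subset_Ioo (neg_le_neg h) h
  exact ⟨fun t ht => hη.c1_left t (hI ht), hη.c1_right.mono hI, fun t ht => hη.velocity t (hI ht),
    fun t ht => hη.acceleration t (hI ht), hη.init_left, hη.init_right⟩

/-- The vector field `(g, w) ↦ (w, f)` of the equation in the coordinates of `D^s × H^s`. -/
def lagrangianField (hs : 3 / 2 < s) (p : Hs s × Hs s) : Hs s × Hs s :=
  (p.2, Hs.force hs p.1 p.2)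

theorem contDiffAt_lagrangianField (hs : 3 / 2 < s) {p : Hs s × Hs s}
    (hp : p.1 ∈ Hs.smallDisplacements hs) : ContDiffAt ℝ 1 (lagrangianField hs) p :=
  contDiffAt_snd.prodMk (Hs.contDiffAt_force hs hp)

/-- Where a solution has a small displacement, it is locally an integral curve of the vector
field. -/
theorem IsLagrangianSolution.exists_hasDerivAt (hs : 3 / 2 < s) {T : ℝ} {u : Hs s} {η : ℝ → Ds s}
    {v : ℝ → Hs s} (hη : IsLagrangianSolution T u η v) {t : ℝ} (ht : t ∈ Ioo (-T) T) {g₀ : Hs s}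
    (hg₀ : g₀ ∈ Hs.smallDisplacements hs) (hηg₀ : IsDisplacement (η t) g₀) :
    ∃ g : ℝ → Hs s, g t = g₀ ∧ ∀ᶠ r in 𝓝 t, IsDisplacement (η r) (g r) ∧
      HasDerivAt (fun r => (g r, v r)) (lagrangianField hs (g r, v r)) r := by
  obtain ⟨γ, hγ, hηγ⟩ := hη.c1_left t ht
  obtain ⟨k, hk⟩ := hηg₀.exists_eq_add_intCast hηγ.self_of_nhds
  let g : ℝ → Hs s := fun r => γ r + (k : ℝ) • Hs.one s
  have hg : ContDiffAt ℝ 1 g t := hγ.add contDiffAt_const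
  have hηg : ∀ᶠ r in 𝓝 t, IsDisplacement (η r) (g r) := hηγ.mono fun r hr => hr.add_intCast k
  have hmem : ∀ᶠ r in 𝓝 t, g r ∈ Hs.smallDisplacements hs := by
    refine hg.continuousAt ((Hs.isOpen_smallDisplacements hs).mem_nhds ?_)
    rw [show g t = g₀ from hk.symm]
    exact hg₀
  refine ⟨g, hk.symm, ?_⟩
  filter_upwards [hg.eventually (by simp), eventually_eventually_nhds.2 hηg, hmem,
    Ioo_mem_nhds ht.1 ht.2] with r h1 h2 h3 h4
  refine ⟨h2.self_of_nhds, ((hη.velocity r h4).hasDerivAt h1.continuousAt h2).prodMk ?_⟩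
  have h5 : DifferentiableAt ℝ v r :=
    (hη.c1_right.contDiffAt (Ioo_mem_nhds h4.1 h4.2)).differentiableAt _root_.one_ne_zero
  have h6 : deriv v r = Hs.force hs (g r) (v r) :=
    Hs.toCont_injective (ContinuousMap.ext fun x => Complex.ofReal_injective
      ((hη.acceleration r h4 x).trans (Hs.lagrangianForce_eq h3 h2.self_of_nhds _ x)))
  exact h6 ▸ h5.hasDerivAt

/-- Two solutions with the same initial velocity agree, if one of them stays in the domain of small
displacements: the set of times at which they agree is open and closed, and it contains `0`. -/
theorem IsLagrangianSolution.unique (hs : 3 / 2 < s) {T : ℝ} {u : Hs s} {ξ η : ℝ → Ds s}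
    {z v : ℝ → Hs s} (hξ : IsLagrangianSolution T u ξ z) (hη : IsLagrangianSolution T u η v)
    (hsmall : ∀ t ∈ Ioo (-T) T, ∃ g ∈ Hs.smallDisplacements hs, IsDisplacement (η t) g)
    {t : ℝ} (ht : t ∈ Ioo (-T) T) : ξ t = η t ∧ z t = v t := by
  have hT : 0 < T := by linarith [ht.1, ht.2]
  let A : Set ℝ := {t | t ∈ Ioo (-T) T ∧ ξ t = η t ∧ z t = v t}
  have hA : IsOpen A := by
    refine isOpen_iff_mem_nhds.2 fun t₀ h₀ => ?_
    obtain ⟨hI, hξη, hzv⟩ := h₀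
    obtain ⟨g₀, hg₀, hηg₀⟩ := hsmall t₀ hI
    -- both solutions are lifted near `t₀` with the same displacement `g₀` at `t₀`
    obtain ⟨g, hg, hgd⟩ := hη.exists_hasDerivAt hs hI hg₀ hηg₀
    obtain ⟨γ, hγ, hγd⟩ := hξ.exists_hasDerivAt hs hI hg₀ (hξη ▸ hηg₀)
    obtain ⟨K, S, hS, hK⟩ :=
      (contDiffAt_lagrangianField hs (p := (g₀, v t₀)) hg₀).exists_lipschitzOnWith
    have hgS : ∀ᶠ r in 𝓝 t₀, (g r, v r) ∈ S := by
      have h := hgd.self_of_nhds.2.continuousAt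
      rw [ContinuousAt, hg] at h
      exact h hS
    have hγS : ∀ᶠ r in 𝓝 t₀, (γ r, z r) ∈ S := by
      have h := hγd.self_of_nhds.2.continuousAt
      rw [ContinuousAt, hγ, hzv] at h
      exact h hS
    have heq := ODE_solution_unique_of_eventually (v := fun _ => lagrangianField hs)
      (s := fun _ => S) (t₀ := t₀) (K := K) (.of_forall fun _ => hK)
      (f := fun r => (γ r, z r)) (g := fun r => (g r, v r))
      ((hγd.and hγS).mono fun r hr => ⟨hr.1.2, hr.2⟩)
      ((hgd.and hgS).mono fun r hr => ⟨hr.1.2, hr.2⟩) (by rw [hg, hγ, hzv])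
    filter_upwards [heq, hgd, hγd, Ioo_mem_nhds hI.1 hI.2] with r h1 h2 h3 h4
    obtain ⟨h5, h6⟩ := Prod.ext_iff.1 h1
    have h7 : γ r = g r := h5
    exact ⟨h4, h3.1.ds_eq (h7 ▸ h2.1), h6⟩
  have hclosed : closure A ∩ Ioo (-T) T ⊆ A := by
    rintro t₀ ⟨hcl, hI⟩
    have hfreq := mem_closure_iff_frequently.1 hcl
    have hz : ∀ {w : ℝ → Hs s}, ContDiffOn ℝ 1 w (Ioo (-T) T) → Tendsto w (𝓝 t₀) (𝓝 (w t₀)) :=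
      fun hw => hw.continuousOn.continuousAt (Ioo_mem_nhds hI.1 hI.2)
    refine ⟨hI, Ds.ext (Homeomorph.ext fun x => ?_), ?_⟩
    · exact tendsto_nhds_unique_of_frequently_eq ((hξ.c1_left t₀ hI).continuousAt_apply hs x)
        ((hη.c1_left t₀ hI).continuousAt_apply hs x) (hfreq.mono fun r hr => by rw [hr.2.1])
    · exact tendsto_nhds_unique_of_frequently_eq (hz hξ.c1_right) (hz hη.c1_right)
        (hfreq.mono fun r hr => hr.2.2)
  have h0 : (Ioo (-T) T ∩ A).Nonempty := by
    have hI : (0 : ℝ) ∈ Ioo (-T) T := ⟨by linarith, hT⟩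
    exact ⟨0, hI, hI, Ds.ext (Homeomorph.ext fun x => (hξ.init_left x).trans (hη.init_left x).symm),
      hξ.init_right.trans hη.init_right.symm⟩
  exact (isPreconnected_Ioo.subset_of_closure_inter_subset hA h0 hclosed ht).2

end Uniqueness

end

theorem mainTheorem2 (s : ℝ) (hs : 3 / 2 < s) (u₀ : Hs s) :
    ∃ T : ℝ, 0 < T ∧ ∃ N : Set (Hs s), IsOpen N ∧ u₀ ∈ N ∧
      ∃ (η : Hs s → ℝ → Ds s) (v : Hs s → ℝ → Hs s),
        (∀ u ∈ N, IsLagrangianSolution T u (η u) (v u) ∧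
          ∀ T' : ℝ, 0 < T' → T' ≤ T → ∀ (ξ : ℝ → Ds s) (z : ℝ → Hs s),
            IsLagrangianSolution T' u ξ z →
              ∀ t ∈ Ioo (-T') T', ξ t = η u t ∧ z t = v u t) ∧
        (∀ p ∈ Ioo (-T) T ×ˢ N, Ds.IsC1At (fun q : ℝ × Hs s => η q.2 q.1) p) ∧
        ContDiffOn ℝ 1 (fun q : ℝ × Hs s => v q.2 q.1) (Ioo (-T) T ×ˢ N) := by
  classical
  have := Hs.completeSpace (Hs.half_lt_of_three_half_lt hs)
  have h0 := Hs.zero_mem_smallDisplacements hs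
  obtain ⟨φ, hφ, hflow⟩ := (contDiffAt_lagrangianField hs (p := (0, u₀)) h0).exists_contDiffAt_flow
  -- the flow restricted to the initial data `(id, u)`
  let Φ : ℝ × Hs s → Hs s × Hs s := fun q => φ (q.1, (0, q.2))
  have hi : ContDiff ℝ 1 fun q : ℝ × Hs s => (q.1, ((0 : Hs s), q.2)) := by fun_prop
  have hφ₀ : φ (0, (0, u₀)) = (0, u₀) := hflow.self_of_nhds.1
  have hsmall : ∀ᶠ p in 𝓝 (0, ((0 : Hs s), u₀)), (φ p).1 ∈ Hs.smallDisplacements hs := by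
    refine (continuous_fst.continuousAt.comp hφ.continuousAt) ?_
    refine (Hs.isOpen_smallDisplacements hs).mem_nhds ?_
    simpa [hφ₀] using h0
  have hev := (hi.continuous.tendsto (0, u₀)).eventually
    ((hφ.eventually (by simp)).and (hflow.and hsmall))
  obtain ⟨T, hT, hball⟩ := Metric.eventually_nhds_iff_ball.1 hev
  have hbox : ∀ q ∈ Ioo (-T) T ×ˢ Metric.ball u₀ T, ContDiffAt ℝ 1 Φ q ∧
      Φ (0, q.2) = (0, q.2) ∧ HasDerivAt (fun t => Φ (t, q.2)) (lagrangianField hs (Φ q)) q.1 ∧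
      (Φ q).1 ∈ Hs.smallDisplacements hs := by
    intro q hq
    have hq' : q ∈ Metric.ball ((0 : ℝ), u₀) T := by
      rw [← ball_prod_same, Real.ball_eq_Ioo, zero_sub, zero_add]
      exact hq
    obtain ⟨h1, ⟨h2, h3⟩, h4⟩ := hball q hq'
    exact ⟨h1.comp q hi.contDiffAt, h2, h3, h4⟩
  -- outside the box, where `Φ` is not known to be small, the value of `η` is irrelevant
  let η : Hs s → ℝ → Ds s := fun u t =>
    if h : (Φ (t, u)).1 ∈ Hs.smallDisplacements hs
    then Ds.ofDisplacement hs (Φ (t, u)).1 (Hs.jacobian_pos hs h)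
    else Ds.ofDisplacement hs 0 (Hs.jacobian_pos hs h0)
  have hη : ∀ q ∈ Ioo (-T) T ×ˢ Metric.ball u₀ T, IsDisplacement (η q.2 q.1) (Φ q).1 := by
    intro q hq
    have h : (Φ (q.1, q.2)).1 ∈ Hs.smallDisplacements hs := (hbox q hq).2.2.2
    simp only [η, dif_pos h]
    exact Ds.isDisplacement_ofDisplacement hs _ _
  have hopen : IsOpen (Ioo (-T) T ×ˢ Metric.ball u₀ T) := isOpen_Ioo.prod Metric.isOpen_ball
  have hη1 : ∀ q ∈ Ioo (-T) T ×ˢ Metric.ball u₀ T, ∀ᶠ p in 𝓝 q,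
      IsDisplacement (η p.2 p.1) (Φ p).1 := fun q hq => by
    filter_upwards [hopen.mem_nhds hq] with p hp using hη p hp
  have h0T : (0 : ℝ) ∈ Ioo (-T) T := ⟨by linarith, hT⟩
  have hsol : ∀ u ∈ Metric.ball u₀ T,
      IsLagrangianSolution T u (η u) (fun t => (Φ (t, u)).2) := by
    intro u hu
    have hc : ∀ t, Tendsto (fun r : ℝ => (r, u)) (𝓝 t) (𝓝 (t, u)) := fun t =>
      Continuous.tendsto (by fun_prop) t
    have hc1 : ∀ t ∈ Ioo (-T) T, ContDiffAt ℝ 1 (fun r => Φ (r, u)) t := fun t ht =>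
      ContDiffAt.comp t (g := Φ) (hbox (t, u) ⟨ht, hu⟩).1 (by fun_prop)
    have hd : ∀ t ∈ Ioo (-T) T, HasDerivAt (fun r => (Φ (r, u)).2)
        (Hs.force hs (Φ (t, u)).1 (Φ (t, u)).2) t := fun t ht =>
      (hbox (t, u) ⟨ht, hu⟩).2.2.1.snd
    refine ⟨fun t ht => ⟨fun r => (Φ (r, u)).1, (hc1 t ht).fst, ?_⟩,
      fun t ht => (hc1 t ht).snd.contDiffWithinAt, fun t ht => ⟨fun r => (Φ (r, u)).1, ?_, ?_⟩,
      fun t ht x => ?_, fun x => ?_, ?_⟩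
    · exact (hc t).eventually (hη1 (t, u) ⟨ht, hu⟩)
    · exact (hbox (t, u) ⟨ht, hu⟩).2.2.1.fst
    · exact (hc t).eventually (hη1 (t, u) ⟨ht, hu⟩)
    · have hq : (t, u) ∈ Ioo (-T) T ×ˢ Metric.ball u₀ T := ⟨ht, hu⟩
      rw [(hd t ht).deriv, Hs.lagrangianForce_eq (hbox (t, u) hq).2.2.2 (hη (t, u) hq)]
    · have h1 := hη (0, u) ⟨h0T, hu⟩ x
      rw [(hbox (0, u) ⟨h0T, hu⟩).2.1] at h1
      simpa using h1
    · rw [(hbox (0, u) ⟨h0T, hu⟩).2.1]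
  refine ⟨T, hT, Metric.ball u₀ T, Metric.isOpen_ball, Metric.mem_ball_self hT, η,
    fun u t => (Φ (t, u)).2, fun u hu => ⟨hsol u hu, fun T' hT' hTT' ξ z hξ t ht => ?_⟩,
    fun q hq => ⟨fun p => (Φ p).1, (hbox q hq).1.fst, hη1 q hq⟩,
    fun q hq => (hbox q hq).1.snd.contDiffWithinAt⟩
  refine hξ.unique hs ((hsol u hu).mono hTT') (fun r hr => ?_) ht
  have hr' : (r, u) ∈ Ioo (-T) T ×ˢ Metric.ball u₀ T :=
    ⟨Ioo_subset_Ioo (neg_le_neg hTT') hTT' hr, hu⟩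
  exact ⟨_, (hbox (r, u) hr').2.2.2, hη (r, u) hr'⟩
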